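/- An MV-algebra is a structure $(A,\oplus,\neg,0)$ such that $(A,\oplus,0)$ is a commutative monoid and, with $1:=\neg 0$, the laws $\neg\neg x=x$, $x\oplus 1=1$ and $\neg(\neg x\oplus y)\oplus y=\neg(\neg y\oplus x)\oplus x$ hold. Homomorphisms are the maps preserving $\oplus,\neg,0$; they are the arrows of the category $\mathsf{MV}$. Put $x\odot y:=\neg(\neg x\oplus\neg y)$, $x\ominus y:=x\odot\neg y$, $d(x,y):=(x\ominus y)\oplus(y\ominus x)$, and $x\le y$ iff $\neg x\oplus y=1$. The interval $[0,1]$ is an MV-algebra with $x\oplus y=\min\{x+y,1\}$, $\neg x=1-x$, and for a topological space $X$ the set $C(X)$ of continuous functions $X\to[0,1]$ is an MV-algebra with pointwise operations. An ideal of $A$ is a subset containing $0$, downward closed and closed under $\oplus$; $A/I$ is the quotient by the congruence $x\equiv y \iff d(x,y)\in I$. Let $\operatorname{Max}A$ be the set of maximal (proper) ideals of $A$, with the topology whose closed sets are the sets $\{\mathfrak m\in\operatorname{Max}A\mid I\subseteq\mathfrak m\}$, $I$ an ideal of $A$. For each $\mathfrak m\in\operatorname{Max}A$ there is exactly one MV-homomorphism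 $\mathfrak h_{\mathfrak m}\colon A/\mathfrak m\to[0,1]$. The evaluation map is the homomorphism $\eta_A\colon A\to C(\operatorname{Max}A)$, $\eta_A(a)(\mathfrak m):=\mathfrak h_{\mathfrak m}(a/\mathfrak m)$. A $\delta$-algebra is an MV-algebra $A$ with an operation $\delta\colon A^{\{1,2,\dots\}}\to A$ satisfying, with $f(x):=\delta(x,0,0,\ldots)$, the identities - (A1) $d\bigl(\delta(x_1,x_2,\ldots),\delta(x_1,0,0,\ldots)\bigr)=\delta(0,x_2,x_3,\ldots)$; - (A2) $f(\delta(x_1,x_2,\ldots))=\delta(f(x_1),f(x_2),\ldots)$; - (A3) $\delta(x,x,\ldots)=x$; - (A4) $\delta(0,x_1,x_2,\ldots)=f(\delta(x_1,x_2,\ldots))$; - (A5) $\delta(x_1\oplus y_1,x_2\oplus y_2,\ldots)\ge\delta(x_1,x_2,\ldots)$; - (A6) $f(x\ominus y)=f(x)\ominus f(y)$. Let $\mathsf{VA}$ be the category of $\delta$-algebras and MV-homomorphisms preserving $\delta$, with its forgetful functor $\mathsf{VA}\to\mathsf{MV}$ sending a $\delta$-algebra to its underlying MV-algebra. **Theorem.**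 The full subcategory of $\mathsf{MV}$ on the objects in the image of the forgetful functor $\mathsf{VA}\to\mathsf{MV}$ equals the full subcategory $\mathsf{MV}_{C}$ of $\mathsf{MV}$ on the MV-algebras $A$ for which $\eta_A\colon A\to C(\operatorname{Max}A)$ is an isomorphism. That is, an MV-algebra $A$ is the MV-reduct of some $\delta$-algebra if and only if $\eta_A$ is an isomorphism. -/

import Mathlib

open CategoryTheory

universe u v

/-- An MV-algebra `(A, ⊕, ¬, 0)`. -/
class MVAlgebra (A : Type u) where
  zero : A
  oplus : A → A → A
  neg : A → A
  oplus_assoc : ∀ x y z : A, oplus (oplus x y) z = oplus x (oplus y z)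
  oplus_comm : ∀ x y : A, oplus x y = oplus y x
  oplus_zero : ∀ x : A, oplus x zero = x
  neg_neg : ∀ x : A, neg (neg x) = x
  oplus_neg_zero : ∀ x : A, oplus x (neg zero) = neg zero
  mv_law : ∀ x y : A, oplus (neg (oplus (neg x) y)) y = oplus (neg (oplus (neg y) x)) x

infixl:65 " ⊕ₘ " => MVAlgebra.oplus
prefix:100 "∼ₘ" => MVAlgebra.neg

namespace MVAlgebra

section Basic

variable {A : Type u} [MVAlgebra A]

/-- `1 := ¬ 0`. -/
def one : A := ∼ₘ(zero : A)

/-- `x ⊙ y := ¬ (¬ x ⊕ ¬ y)`. -/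
def odot (x y : A) : A := ∼ₘ(∼ₘx ⊕ₘ ∼ₘy)

/-- Truncated subtraction `x ⊖ y := x ⊙ ¬ y`. -/
def ominus (x y : A) : A := odot x (∼ₘy)

/-- Chang's distance `d(x, y) := (x ⊖ y) ⊕ (y ⊖ x)`. -/
def cdist (x y : A) : A := ominus x y ⊕ₘ ominus y x

/-- The underlying order of an MV-algebra: `x ≤ y` iff `¬ x ⊕ y = 1`. -/
def le (x y : A) : Prop := ∼ₘx ⊕ₘ y = one

/-! Elementary facts, used to construct quotients and the evaluation map. -/

lemma neg_zero : ∼ₘ(zero : A) = one := rfl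

lemma neg_one : ∼ₘ(one : A) = zero := neg_neg _

lemma oplus_one (x : A) : x ⊕ₘ one = one := oplus_neg_zero x

lemma one_oplus (x : A) : one ⊕ₘ x = one := by rw [oplus_comm, oplus_one]

lemma zero_oplus (x : A) : zero ⊕ₘ x = x := by rw [oplus_comm, oplus_zero]

lemma oplus_left_comm (x y z : A) : x ⊕ₘ (y ⊕ₘ z) = y ⊕ₘ (x ⊕ₘ z) := by
  rw [← oplus_assoc, oplus_comm x y, oplus_assoc]

lemma neg_oplus_self (x : A) : ∼ₘx ⊕ₘ x = one := by
  have h := mv_law x one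
  rw [oplus_one (∼ₘx), oplus_one, neg_one, zero_oplus] at h
  exact h.symm

lemma oplus_neg_self (x : A) : x ⊕ₘ ∼ₘx = one := by rw [oplus_comm, neg_oplus_self]

lemma le_refl (x : A) : le x x := neg_oplus_self x

lemma le_antisymm {x y : A} (h : le x y) (h' : le y x) : x = y := by
  have := mv_law x y
  unfold le at h h'
  rw [h, h', neg_one, zero_oplus, zero_oplus] at this
  exact this.symm

lemma oplus_ominus_of_le {x y : A} (h : le x y) : x ⊕ₘ ominus y x = y := by
  have := mv_law x y
  unfold le at h
  rw [h, neg_one, zero_oplus] at this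
  rw [ominus, odot, neg_neg, oplus_comm, ← this]

lemma le_oplus_right (x z : A) : le x (x ⊕ₘ z) := by
  rw [le, ← oplus_assoc, neg_oplus_self, one_oplus]

lemma le_oplus_left (x z : A) : le x (z ⊕ₘ x) := by
  rw [oplus_comm]; exact le_oplus_right x z

lemma le_trans {x y z : A} (h : le x y) (h' : le y z) : le x z := by
  rw [← oplus_ominus_of_le h', ← oplus_ominus_of_le h, oplus_assoc]
  exact le_oplus_right _ _

lemma zero_le (x : A) : le zero x := by rw [le, neg_zero, one_oplus]

lemma le_one (x : A) : le x one := by rw [le, oplus_one]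

lemma eq_zero_of_le {x : A} (h : le x zero) : x = zero := le_antisymm h (zero_le x)

lemma eq_one_of_le {x : A} (h : le one x) : x = one := le_antisymm (le_one x) h

lemma oplus_le_left (z : A) {x y : A} (h : le x y) : le (z ⊕ₘ x) (z ⊕ₘ y) := by
  rw [← oplus_ominus_of_le h, ← oplus_assoc]
  exact le_oplus_right _ _

lemma oplus_le {x y w z : A} (h : le x y) (h' : le w z) : le (x ⊕ₘ w) (y ⊕ₘ z) := by
  refine le_trans (oplus_le_left x h') ?_
  rw [oplus_comm x, oplus_comm y]
  exact oplus_le_left z h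

lemma neg_le {x y : A} (h : le x y) : le (∼ₘy) (∼ₘx) := by
  rw [le, neg_neg, oplus_comm]; exact h

lemma le_neg_comm {x y : A} (h : le x (∼ₘy)) : le y (∼ₘx) := by
  have := neg_le h
  rwa [neg_neg] at this

lemma neg_le_comm {x y : A} (h : le (∼ₘx) y) : le (∼ₘy) x := by
  have := neg_le h
  rwa [neg_neg] at this

lemma ominus_eq (x y : A) : ominus x y = ∼ₘ(∼ₘx ⊕ₘ y) := by
  rw [ominus, odot, neg_neg]

lemma ominus_le_iff {x y z : A} : le (ominus x y) z ↔ le x (y ⊕ₘ z) := by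
  rw [ominus_eq, le, neg_neg, le, oplus_assoc]

lemma le_oplus_ominus (x y : A) : le x (y ⊕ₘ ominus x y) := ominus_le_iff.1 (le_refl _)

lemma ominus_le_self (x y : A) : le (ominus x y) x := ominus_le_iff.2 (le_oplus_left x y)

lemma ominus_zero (x : A) : ominus x zero = x := by
  rw [ominus_eq, oplus_zero, neg_neg]

lemma zero_ominus (x : A) : ominus zero x = zero := by
  rw [ominus_eq, neg_zero, one_oplus, neg_one]

lemma ominus_self (x : A) : ominus x x = zero := by
  rw [ominus_eq, neg_oplus_self, neg_one]

lemma ominus_eq_zero_iff {x y : A} : ominus x y = zero ↔ le x y := by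
  constructor
  · intro h
    have := le_oplus_ominus x y
    rwa [h, oplus_zero] at this
  · intro h
    apply eq_zero_of_le
    rw [ominus_le_iff, oplus_zero]
    exact h

lemma ominus_le_ominus {x y w z : A} (h : le x y) (h' : le z w) :
    le (ominus x w) (ominus y z) := by
  rw [ominus_le_iff]
  refine le_trans h (le_trans (le_oplus_ominus y z) (oplus_le h' (le_refl _)))

lemma ominus_le_neg (x y : A) : le (ominus x y) (∼ₘy) := by
  rw [ominus_le_iff, oplus_neg_self]; exact le_one x

lemma ominus_ominus (x y z : A) : ominus (ominus x y) z = ominus x (y ⊕ₘ z) := by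
  rw [ominus_eq, ominus_eq, ominus_eq, neg_neg, oplus_assoc]

lemma oplus_ominus_cancel {t w : A} (h : le w (∼ₘt)) : ominus (t ⊕ₘ w) t = w := by
  have h2 := mv_law (∼ₘw) t
  rw [neg_neg, oplus_comm (∼ₘt)] at h2
  unfold le at h
  rw [h, neg_one, zero_oplus] at h2
  rw [ominus_eq, oplus_comm t w, h2, neg_neg]

lemma neg_ominus_neg (x y : A) : ominus (∼ₘx) (∼ₘy) = ominus y x := by
  rw [ominus_eq, ominus_eq, neg_neg, oplus_comm]

lemma ominus_triangle (x y z : A) : le (ominus x z) (ominus x y ⊕ₘ ominus y z) := by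
  rw [ominus_le_iff]
  refine le_trans (le_oplus_ominus x y) ?_
  rw [oplus_left_comm, oplus_comm y]
  refine oplus_le_left _ (le_oplus_ominus y z)

lemma ominus_oplus_le (x y u v : A) :
    le (ominus (x ⊕ₘ u) (y ⊕ₘ v)) (ominus x y ⊕ₘ ominus u v) := by
  rw [ominus_le_iff]
  have h := oplus_le (le_oplus_ominus x y) (le_oplus_ominus u v)
  rwa [oplus_assoc, oplus_left_comm (ominus x y), ← oplus_assoc] at h

/-- Positive differences are orthogonal. -/
lemma eq_zero_of_le_ominus {x y w : A} (h : le w (ominus x y)) (h' : le w (ominus y x)) :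
    w = zero := by
  -- `t = x ∧ y`
  set t := ominus x (ominus x y) with ht
  have htx : le t x := ominus_le_self _ _
  have hty : le t y := by
    rw [ht, ominus_le_iff, oplus_comm]; exact le_oplus_ominus x y
  have hwx : le w (ominus x t) := le_trans h (ominus_le_ominus (le_refl x) hty)
  have hwy : le w (ominus y t) := le_trans h' (ominus_le_ominus (le_refl y) htx)
  have h1 : le (t ⊕ₘ w) x := by
    have := oplus_le_left t hwx
    rwa [oplus_ominus_of_le htx] at this
  have h2 : le (t ⊕ₘ w) y := by
    have := oplus_le_left t hwy
    rwa [oplus_ominus_of_le hty] at this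
  have hxy : le (ominus x y) (ominus x (t ⊕ₘ w)) := ominus_le_ominus (le_refl x) h2
  have h3 : le (t ⊕ₘ w) t := by
    -- `t ⊕ w` is a common lower bound
    have h4 : ominus x (ominus x (t ⊕ₘ w)) = t ⊕ₘ w := by
      have e := oplus_ominus_of_le h1
      have hb : le (t ⊕ₘ w) (∼ₘ(ominus x (t ⊕ₘ w))) := le_neg_comm (ominus_le_neg _ _)
      have := oplus_ominus_cancel hb
      rwa [oplus_comm, e] at this
    rw [← h4]
    exact ominus_le_ominus (le_refl x) hxy
  have h4 : t ⊕ₘ w = t := le_antisymm h3 (le_oplus_right _ _)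
  have h5 := oplus_ominus_cancel (le_trans hwx (ominus_le_neg x t))
  rw [h4, ominus_self] at h5
  exact h5.symm

/-- `n x = x ⊕ ⋯ ⊕ x`. -/
def nmul (x : A) : ℕ → A
  | 0 => zero
  | n + 1 => nmul x n ⊕ₘ x

lemma nmul_add (x : A) (m n : ℕ) : nmul x (m + n) = nmul x m ⊕ₘ nmul x n := by
  induction n with
  | zero => simp [nmul, oplus_zero]
  | succ n ih => rw [← Nat.add_assoc, nmul, nmul, ih, oplus_assoc]

lemma eq_zero_of_le_nmul {u v : A} (huv : ∀ w, le w u → le w v → w = zero) (n : ℕ) :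
    ∀ w, le w (nmul u n) → le w v → w = zero := by
  induction n with
  | zero => intro w h _; exact eq_zero_of_le h
  | succ n ih =>
    intro w h hv
    rw [nmul] at h
    have h1 : ominus w (nmul u n) = zero :=
      huv _ (ominus_le_iff.2 h) (le_trans (ominus_le_self _ _) hv)
    exact ih w (ominus_eq_zero_iff.1 h1) hv

end Basic

end MVAlgebra

open MVAlgebra

/-- Homomorphisms of MV-algebras. -/
@[ext]
structure MVHom (A : Type u) (B : Type v) [MVAlgebra A] [MVAlgebra B] where
  toFun : A → B
  map_zero : toFun zero = zero
  map_neg : ∀ x, toFun (∼ₘx) = ∼ₘ(toFun x)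
  map_oplus : ∀ x y, toFun (x ⊕ₘ y) = toFun x ⊕ₘ toFun y

namespace MVHom

instance {A : Type u} {B : Type v} [MVAlgebra A] [MVAlgebra B] :
    CoeFun (MVHom A B) (fun _ => A → B) := ⟨MVHom.toFun⟩

/-- The identity homomorphism. -/
def id (A : Type u) [MVAlgebra A] : MVHom A A :=
  ⟨fun x => x, rfl, fun _ => rfl, fun _ _ => rfl⟩

/-- Composition of homomorphisms. -/
def comp {A B C : Type*} [MVAlgebra A] [MVAlgebra B] [MVAlgebra C]
    (g : MVHom B C) (f : MVHom A B) : MVHom A C where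
  toFun x := g (f x)
  map_zero := by rw [f.map_zero, g.map_zero]
  map_neg x := by rw [f.map_neg, g.map_neg]
  map_oplus x y := by rw [f.map_oplus, g.map_oplus]

end MVHom

/-! ### Ideals, maximal ideals and quotients -/

/-- Ideals of an MV-algebra. -/
@[ext]
structure MVIdeal (A : Type u) [MVAlgebra A] where
  carrier : Set A
  zero_mem : zero ∈ carrier
  mem_of_le : ∀ {x y : A}, le x y → y ∈ carrier → x ∈ carrier
  oplus_mem : ∀ {x y : A}, x ∈ carrier → y ∈ carrier → x ⊕ₘ y ∈ carrier

namespace MVIdeal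

variable {A : Type u} [MVAlgebra A]

/-- An ideal is maximal if it is proper, and maximal with respect to inclusion among the proper
ideals. -/
def IsMaximal (I : MVIdeal A) : Prop :=
  I.carrier ≠ Set.univ ∧
    ∀ J : MVIdeal A, J.carrier ≠ Set.univ → I.carrier ⊆ J.carrier → J.carrier = I.carrier

/-- The congruence `x ≡ y` iff `d(x, y) ∈ I`. -/
def setoid (I : MVIdeal A) : Setoid A where
  r x y := cdist x y ∈ I.carrier
  iseqv := by
    refine ⟨fun x => ?_, fun {x y} h => ?_, fun {x y z} h h' => ?_⟩
    · rw [cdist, ominus_self, oplus_zero]; exact I.zero_mem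
    · rw [cdist, oplus_comm]; exact h
    · refine I.mem_of_le ?_ (I.oplus_mem h h')
      refine le_trans (oplus_le (ominus_triangle x y z) (ominus_triangle z y x)) ?_
      have e : ominus x y ⊕ₘ ominus y z ⊕ₘ (ominus z y ⊕ₘ ominus y x)
          = cdist x y ⊕ₘ cdist y z := by
        simp only [cdist, oplus_assoc]
        rw [oplus_comm (ominus z y) (ominus y x), oplus_left_comm (ominus y z) (ominus y x)]
      rw [e]
      exact le_refl _

/-- The quotient `A / I`. -/
def Quot (I : MVIdeal A) : Type u := Quotient I.setoid

/-- The class `a / I`. -/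
def cls (I : MVIdeal A) (a : A) : I.Quot := Quotient.mk I.setoid a

instance (I : MVIdeal A) : MVAlgebra I.Quot where
  zero := I.cls zero
  neg := Quotient.map (fun x => ∼ₘx) (by
    intro x y h
    change cdist (∼ₘx) (∼ₘy) ∈ I.carrier
    rw [cdist, neg_ominus_neg, neg_ominus_neg, oplus_comm]
    exact h)
  oplus := Quotient.map₂ (fun x y => x ⊕ₘ y) (by
    intro x x' hx y y' hy
    change cdist (x ⊕ₘ y) (x' ⊕ₘ y') ∈ I.carrier
    refine I.mem_of_le ?_ (I.oplus_mem hx hy)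
    refine le_trans (oplus_le (ominus_oplus_le x x' y y') (ominus_oplus_le x' x y' y)) ?_
    have e : ominus x x' ⊕ₘ ominus y y' ⊕ₘ (ominus x' x ⊕ₘ ominus y' y)
        = cdist x x' ⊕ₘ cdist y y' := by
      simp only [cdist, oplus_assoc]
      rw [oplus_left_comm (ominus y y') (ominus x' x)]
    rw [e]
    exact le_refl _)
  oplus_assoc := by
    rintro ⟨x⟩ ⟨y⟩ ⟨z⟩; exact congrArg I.cls (oplus_assoc x y z)
  oplus_comm := by rintro ⟨x⟩ ⟨y⟩; exact congrArg I.cls (oplus_comm x y)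
  oplus_zero := by rintro ⟨x⟩; exact congrArg I.cls (oplus_zero x)
  neg_neg := by rintro ⟨x⟩; exact congrArg I.cls (neg_neg x)
  oplus_neg_zero := by rintro ⟨x⟩; exact congrArg I.cls (oplus_neg_zero x)
  mv_law := by rintro ⟨x⟩ ⟨y⟩; exact congrArg I.cls (mv_law x y)

/-- The quotient map as a homomorphism. -/
def clsHom (I : MVIdeal A) : MVHom A I.Quot := ⟨I.cls, rfl, fun _ => rfl, fun _ _ => rfl⟩

lemma cls_eq_zero_iff (I : MVIdeal A) (a : A) : I.cls a = zero ↔ a ∈ I.carrier := by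
  have h : I.cls a = I.cls zero ↔ cdist a zero ∈ I.carrier := Quotient.eq
  rw [cdist, ominus_zero, zero_ominus, oplus_zero] at h
  exact h

lemma one_notMem {I : MVIdeal A} (hI : I.carrier ≠ Set.univ) : one ∉ I.carrier :=
  fun h => hI (Set.eq_univ_of_forall fun x => I.mem_of_le (le_one x) h)

lemma exists_of_notMem {I : MVIdeal A} (hI : I.IsMaximal) {u : A} (hu : u ∉ I.carrier) :
    ∃ i ∈ I.carrier, ∃ n, i ⊕ₘ nmul u n = one := by
  by_contra hcon
  push Not at hcon
  let J : MVIdeal A :=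
    { carrier := {w | ∃ i ∈ I.carrier, ∃ n, le w (i ⊕ₘ nmul u n)}
      zero_mem := ⟨zero, I.zero_mem, 0, zero_le _⟩
      mem_of_le := by
        rintro x y hxy ⟨i, hi, n, h⟩
        exact ⟨i, hi, n, le_trans hxy h⟩
      oplus_mem := by
        rintro x y ⟨i, hi, n, h⟩ ⟨j, hj, k, h'⟩
        refine ⟨i ⊕ₘ j, I.oplus_mem hi hj, n + k, le_trans (oplus_le h h') ?_⟩
        have e : i ⊕ₘ nmul u n ⊕ₘ (j ⊕ₘ nmul u k) = i ⊕ₘ j ⊕ₘ nmul u (n + k) := by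
          rw [nmul_add]
          simp only [oplus_assoc]
          rw [oplus_left_comm (nmul u n) j]
        rw [e]
        exact le_refl _ }
  have hJ : J.carrier ≠ Set.univ := by
    intro h
    have h1 : one ∈ J.carrier := h ▸ Set.mem_univ _
    obtain ⟨i, hi, n, h2⟩ := h1
    exact hcon i hi n (eq_one_of_le h2)
  have hIJ : I.carrier ⊆ J.carrier := fun x hx => ⟨x, hx, 0, le_oplus_right _ _⟩
  refine hu ((hI.2 J hJ hIJ) ▸ ⟨zero, I.zero_mem, 1, ?_⟩)
  exact le_trans (le_oplus_left u zero) (le_oplus_left _ _)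

/-- If `u ∧ v = 0`, then a maximal ideal contains `u` or `v`. -/
lemma mem_or_mem {I : MVIdeal A} (hI : I.IsMaximal) {u v : A}
    (huv : ∀ w, le w u → le w v → w = zero) : u ∈ I.carrier ∨ v ∈ I.carrier := by
  by_cases hu : u ∈ I.carrier
  · exact Or.inl hu
  · right
    obtain ⟨i, hi, n, h⟩ := exists_of_notMem hI hu
    have h1 : ominus v i = zero := by
      refine eq_zero_of_le_nmul huv n _ ?_ (ominus_le_self _ _)
      rw [ominus_le_iff, h]
      exact le_one v
    exact I.mem_of_le (ominus_eq_zero_iff.1 h1) hi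

lemma quot_le_total {I : MVIdeal A} (hI : I.IsMaximal) (x y : I.Quot) : le x y ∨ le y x := by
  obtain ⟨x, rfl⟩ := Quotient.exists_rep x
  obtain ⟨y, rfl⟩ := Quotient.exists_rep y
  change le (I.cls x) (I.cls y) ∨ le (I.cls y) (I.cls x)
  have h := mem_or_mem hI (u := ominus x y) (v := ominus y x)
    (fun w h h' => eq_zero_of_le_ominus h h')
  rw [← I.cls_eq_zero_iff, ← I.cls_eq_zero_iff] at h
  rw [← ominus_eq_zero_iff, ← ominus_eq_zero_iff]
  exact h

lemma quot_zero_ne_one {I : MVIdeal A} (hI : I.IsMaximal) : (zero : I.Quot) ≠ one := by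
  intro h
  exact one_notMem hI.1 ((I.cls_eq_zero_iff one).1 h.symm)

end MVIdeal

/-! ### The maximal spectrum -/

/-- The set of maximal ideals of `A`. -/
def MaxSpec (A : Type u) [MVAlgebra A] : Type u := {m : MVIdeal A // m.IsMaximal}

namespace MaxSpec

variable {A : Type u} [MVAlgebra A]

/-- `V(S)`: the maximal ideals containing `S`. -/
def V (S : Set A) : Set (MaxSpec A) := {m | S ⊆ m.1.carrier}

/-- The Stone (hull-kernel) topology: the closed sets are the sets `V(I)`, `I` an ideal. -/
instance : TopologicalSpace (MaxSpec A) :=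
  TopologicalSpace.ofClosed {C | ∃ I : MVIdeal A, C = V I.carrier}
    (by
      refine ⟨⟨Set.univ, trivial, fun _ _ => trivial, fun _ _ => trivial⟩, ?_⟩
      refine (Set.eq_empty_of_forall_notMem fun m hm => m.2.1 ?_).symm
      exact Set.univ_subset_iff.1 hm)
    (by
      intro F hF
      let I : MVIdeal A :=
        { carrier := {x | ∀ J : MVIdeal A,
            (∀ K : MVIdeal A, V K.carrier ∈ F → K.carrier ⊆ J.carrier) → x ∈ J.carrier}
          zero_mem := fun J _ => J.zero_mem
          mem_of_le := fun h hy J hJ => J.mem_of_le h (hy J hJ)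
          oplus_mem := fun hx hy J hJ => J.oplus_mem (hx J hJ) (hy J hJ) }
      have hI : ∀ K : MVIdeal A, V K.carrier ∈ F → K.carrier ⊆ I.carrier :=
        fun K hK x hx J hJ => hJ K hK hx
      refine ⟨I, Set.ext fun m => ⟨fun hm x hx => ?_, fun hm C hC => ?_⟩⟩
      · exact hx m.1 fun K hK => hm _ hK
      · obtain ⟨K, rfl⟩ := hF hC
        exact (hI K hC).trans hm)
    (by
      rintro _ ⟨I, rfl⟩ _ ⟨J, rfl⟩
      refine ⟨⟨I.carrier ∩ J.carrier, ⟨I.zero_mem, J.zero_mem⟩,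
        fun h hy => ⟨I.mem_of_le h hy.1, J.mem_of_le h hy.2⟩,
        fun hx hy => ⟨I.oplus_mem hx.1 hy.1, J.oplus_mem hx.2 hy.2⟩⟩, ?_⟩
      refine Set.ext fun m => ⟨?_, fun hm => ?_⟩
      · rintro (h | h)
        · exact fun x hx => h hx.1
        · exact fun x hx => h hx.2
      · by_contra hcon
        have h1 : ¬ (I.carrier ⊆ m.1.carrier) := fun h => hcon (Or.inl h)
        have h2 : ¬ (J.carrier ⊆ m.1.carrier) := fun h => hcon (Or.inr h)
        obtain ⟨a, ha, ham⟩ := Set.not_subset.1 h1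
        obtain ⟨b, hb, hbm⟩ := Set.not_subset.1 h2
        -- meets of `a` and `b`
        have key : ∀ c d : A, le (ominus c (ominus c d)) d := fun c d => by
          rw [ominus_le_iff, oplus_comm]; exact le_oplus_ominus c d
        have t1 : ominus a (ominus a b) ∈ m.1.carrier :=
          hm ⟨I.mem_of_le (ominus_le_self _ _) ha, J.mem_of_le (key a b) hb⟩
        have t2 : ominus b (ominus b a) ∈ m.1.carrier :=
          hm ⟨I.mem_of_le (key b a) ha, J.mem_of_le (ominus_le_self _ _) hb⟩
        rcases MVIdeal.mem_or_mem m.2 (u := ominus a b) (v := ominus b a)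
          (fun w h h' => eq_zero_of_le_ominus h h') with h | h
        · exact ham (m.1.mem_of_le (le_oplus_ominus a (ominus a b)) (m.1.oplus_mem h t1))
        · exact hbm (m.1.mem_of_le (le_oplus_ominus b (ominus b a)) (m.1.oplus_mem h t2)))

end MaxSpec

/-! ### The MV-algebras `[0, 1]` and `C(X)` -/

/-- The MV-algebra `[0, 1]`: `x ⊕ y = min (x + y) 1` and `¬ x = 1 - x`. -/
noncomputable instance : MVAlgebra unitInterval where
  zero := 0
  oplus x y := ⟨min (x + y : ℝ) 1, le_min (add_nonneg x.2.1 y.2.1) zero_le_one, min_le_right _ _⟩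
  neg x := ⟨1 - (x : ℝ), by linarith [x.2.2], by linarith [x.2.1]⟩
  oplus_assoc x y z := by
    have := x.2.1; have := y.2.1; have := z.2.1
    apply Subtype.ext
    change min (min (x + y : ℝ) 1 + z) 1 = min (x + min (y + z : ℝ) 1) 1
    grind
  oplus_comm x y := by
    apply Subtype.ext
    change min (x + y : ℝ) 1 = min (y + x : ℝ) 1
    rw [add_comm]
  oplus_zero x := by
    apply Subtype.ext
    change min (x + 0 : ℝ) 1 = x
    rw [add_zero, min_eq_left x.2.2]
  neg_neg x := by
    apply Subtype.ext
    change 1 - (1 - (x : ℝ)) = x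
    ring
  oplus_neg_zero x := by
    have := x.2.1
    apply Subtype.ext
    change min (x + (1 - 0) : ℝ) 1 = 1 - 0
    grind
  mv_law x y := by
    have := x.2; have := y.2
    apply Subtype.ext
    change min (1 - min (1 - x + y : ℝ) 1 + y) 1 = min (1 - min (1 - y + x : ℝ) 1 + x) 1
    grind

lemma unitInterval.coe_mvzero : ((zero : unitInterval) : ℝ) = 0 := rfl

lemma unitInterval.coe_oplus (x y : unitInterval) :
    ((x ⊕ₘ y : unitInterval) : ℝ) = min (x + y : ℝ) 1 := rfl

lemma unitInterval.coe_mvneg (x : unitInterval) : ((∼ₘx : unitInterval) : ℝ) = 1 - x := rfl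

/-- The MV-algebra `C(X)` of continuous functions `X → [0, 1]`, with pointwise operations. -/
noncomputable instance (X : Type u) [TopologicalSpace X] : MVAlgebra C(X, unitInterval) where
  zero := ⟨fun _ => zero, continuous_const⟩
  oplus f g := ⟨fun x => f x ⊕ₘ g x, by
    refine Continuous.subtype_mk (f := fun x => min (f x + g x : ℝ) 1) ?_ _
    fun_prop⟩
  neg f := ⟨fun x => ∼ₘ(f x), by
    refine Continuous.subtype_mk (f := fun x => 1 - (f x : ℝ)) ?_ _
    fun_prop⟩
  oplus_assoc f g h := ContinuousMap.ext fun x => oplus_assoc (f x) (g x) (h x)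
  oplus_comm f g := ContinuousMap.ext fun x => oplus_comm (f x) (g x)
  oplus_zero f := ContinuousMap.ext fun x => oplus_zero (f x)
  neg_neg f := ContinuousMap.ext fun x => neg_neg (f x)
  oplus_neg_zero f := ContinuousMap.ext fun x => oplus_neg_zero (f x)
  mv_law f g := ContinuousMap.ext fun x => mv_law (f x) (g x)

/-! ### Totally ordered MV-algebras map to `[0, 1]`

Facts needed to know that `A / m` has exactly one homomorphism to `[0, 1]`. -/

namespace MVAlgebra

section Chain

variable {S : Type u} [MVAlgebra S]

lemma odot_eq_ominus (x y : S) : odot x y = ominus y (∼ₘx) := by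
  rw [ominus_eq, odot, oplus_comm]

lemma odot_comm (x y : S) : odot x y = odot y x := by
  rw [odot, odot, oplus_comm]

lemma odot_assoc (x y z : S) : odot (odot x y) z = odot x (odot y z) := by
  simp only [odot, neg_neg, oplus_assoc]

lemma neg_odot (x y : S) : ∼ₘ(odot x y) = ∼ₘx ⊕ₘ ∼ₘy := neg_neg _

lemma neg_oplus (x y : S) : ∼ₘ(x ⊕ₘ y) = odot (∼ₘx) (∼ₘy) := by
  simp only [odot, neg_neg]

lemma oplus_eq_one_iff {x y : S} : x ⊕ₘ y = one ↔ le (∼ₘx) y := by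
  rw [le, neg_neg]

lemma odot_eq_zero_iff {x y : S} : odot x y = zero ↔ le y (∼ₘx) := by
  rw [odot_eq_ominus, ominus_eq_zero_iff]

lemma odot_eq_zero_of_ne (htot : ∀ x y : S, le x y ∨ le y x) {x y : S} (h : x ⊕ₘ y ≠ one) :
    odot x y = zero := by
  rw [odot_eq_zero_iff]
  rw [Ne, oplus_eq_one_iff] at h
  exact (htot _ _).resolve_left h

/-- First exchange identity. -/
lemma exchange {x y z : S} (h1 : odot x y = zero) (h2 : odot y z = zero) :
    odot (x ⊕ₘ y) z = odot x (y ⊕ₘ z) := by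
  have hy : le y (∼ₘx) := odot_eq_zero_iff.1 h1
  have hz : le z (∼ₘy) := odot_eq_zero_iff.1 h2
  rw [odot_eq_ominus, odot_eq_ominus]
  have e : ominus (y ⊕ₘ z) (∼ₘx) = ominus z (ominus (∼ₘx) y) := by
    conv_lhs => rw [← oplus_ominus_of_le hy]
    rw [← ominus_ominus, oplus_ominus_cancel hz]
  rw [e, ominus_eq (∼ₘx), neg_neg]

/-- Dual exchange identity. -/
lemma exchange' {x y z : S} (h1 : x ⊕ₘ y = one) (h2 : y ⊕ₘ z = one) :
    odot x y ⊕ₘ z = x ⊕ₘ odot y z := by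
  have h1' : odot (∼ₘx) (∼ₘy) = zero := by rw [← neg_oplus, h1, neg_one]
  have h2' : odot (∼ₘy) (∼ₘz) = zero := by rw [← neg_oplus, h2, neg_one]
  have := congrArg MVAlgebra.neg (exchange h1' h2')
  rw [neg_odot, neg_odot, neg_oplus, neg_oplus] at this
  simpa only [neg_neg] using this

lemma odot_le_left (x y : S) : le (odot x y) x := by
  have := ominus_le_self x (∼ₘy)
  rwa [ominus, neg_neg] at this

/-- The mixed exchange identity. -/
lemma exchange_mixed (htot : ∀ x y : S, le x y ∨ le y x) {x y z : S} (h1 : x ⊕ₘ y = one)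
    (h2 : y ⊕ₘ z ≠ one) : odot x y ⊕ₘ z = odot x (y ⊕ₘ z) := by
  have ha : le (∼ₘx) y := oplus_eq_one_iff.1 h1
  have hb : ∼ₘx ⊕ₘ odot x y = y := by
    rw [odot_eq_ominus]; exact oplus_ominus_of_le ha
  have h3 : le (odot x y ⊕ₘ z) (∼ₘ(∼ₘx)) := by
    rw [← odot_eq_zero_iff]
    apply odot_eq_zero_of_ne htot
    rw [← oplus_assoc, hb]
    exact h2
  have h4 := oplus_ominus_cancel h3
  rw [← oplus_assoc, hb] at h4
  rw [odot_eq_ominus x (y ⊕ₘ z), h4]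

open Classical in
/-- Addition with carry: `(k, x)` stands for `k + x`. -/
noncomputable def carryAdd (p q : ℕ × S) : ℕ × S :=
  if p.2 ⊕ₘ q.2 = one then (p.1 + q.1 + 1, odot p.2 q.2) else (p.1 + q.1, p.2 ⊕ₘ q.2)

lemma carryAdd_pos {p q : ℕ × S} (h : p.2 ⊕ₘ q.2 = one) :
    carryAdd p q = (p.1 + q.1 + 1, odot p.2 q.2) := if_pos h

lemma carryAdd_neg {p q : ℕ × S} (h : p.2 ⊕ₘ q.2 ≠ one) :
    carryAdd p q = (p.1 + q.1, p.2 ⊕ₘ q.2) := if_neg h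

lemma carryAdd_comm (p q : ℕ × S) : carryAdd p q = carryAdd q p := by
  unfold carryAdd
  rw [oplus_comm p.2, odot_comm p.2, add_comm p.1]

lemma oplus_ne_one_of_le {x y z : S} (h : le x y) (h2 : y ⊕ₘ z ≠ one) : x ⊕ₘ z ≠ one := by
  intro h3
  have := oplus_le h (le_refl z)
  rw [h3] at this
  exact h2 (eq_one_of_le this)

lemma carryAdd_assoc (htot : ∀ x y : S, le x y ∨ le y x) (p q r : ℕ × S) :
    carryAdd (carryAdd p q) r = carryAdd p (carryAdd q r) := by
  obtain ⟨k, x⟩ := p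
  obtain ⟨l, y⟩ := q
  obtain ⟨n, z⟩ := r
  -- the case of a carry in `x + y` only
  have mixed : ∀ (k l n : ℕ) (x y z : S), x ⊕ₘ y = one → y ⊕ₘ z ≠ one →
      carryAdd (carryAdd (k, x) (l, y)) (n, z) = carryAdd (k, x) (carryAdd (l, y) (n, z)) := by
    intro k l n x y z h1 h2
    rw [carryAdd_pos (p := (k, x)) h1, carryAdd_neg (p := (l, y)) h2, carryAdd_neg, carryAdd_pos]
    · simp only [Prod.mk.injEq]
      exact ⟨by ring, exchange_mixed htot h1 h2⟩
    · change x ⊕ₘ (y ⊕ₘ z) = one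
      rw [← oplus_assoc, h1, one_oplus]
    · change odot x y ⊕ₘ z ≠ one
      refine oplus_ne_one_of_le ?_ h2
      rw [odot_comm]; exact odot_le_left y x
  by_cases h1 : x ⊕ₘ y = one <;> by_cases h2 : y ⊕ₘ z = one
  · rw [carryAdd_pos (p := (k, x)) h1, carryAdd_pos (p := (l, y)) h2]
    have e := exchange' h1 h2
    by_cases h3 : x ⊕ₘ odot y z = one
    · rw [carryAdd_pos, carryAdd_pos]
      · simp only [Prod.mk.injEq]
        exact ⟨by ring, odot_assoc x y z⟩
      · exact h3
      · exact e.trans h3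
    · rw [carryAdd_neg, carryAdd_neg]
      · simp only [Prod.mk.injEq]
        exact ⟨by ring, e⟩
      · exact h3
      · exact fun h => h3 (e.symm.trans h)
  · exact mixed k l n x y z h1 h2
  · have h1' : y ⊕ₘ x ≠ one := by rwa [oplus_comm]
    have h2' : z ⊕ₘ y = one := by rwa [oplus_comm]
    have := mixed n l k z y x h2' h1'
    rw [carryAdd_comm (k, x), carryAdd_comm _ (n, z), ← this, carryAdd_comm _ (k, x),
      carryAdd_comm (n, z)]
  · rw [carryAdd_neg (p := (k, x)) h1, carryAdd_neg (p := (l, y)) h2]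
    by_cases h3 : x ⊕ₘ (y ⊕ₘ z) = one
    · rw [carryAdd_pos, carryAdd_pos]
      · simp only [Prod.mk.injEq]
        exact ⟨by ring, exchange (odot_eq_zero_of_ne htot h1) (odot_eq_zero_of_ne htot h2)⟩
      · exact h3
      · exact (oplus_assoc x y z).trans h3
    · rw [carryAdd_neg, carryAdd_neg]
      · simp only [Prod.mk.injEq]
        exact ⟨by ring, oplus_assoc x y z⟩
      · exact h3
      · exact fun h => h3 ((oplus_assoc x y z).symm.trans h)

/-- The `(n + 1)`-fold sum of `p`, with carry. -/
noncomputable def carryIter (p : ℕ × S) : ℕ → ℕ × S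
  | 0 => p
  | n + 1 => carryAdd (carryIter p n) p

lemma carryIter_add (htot : ∀ x y : S, le x y ∨ le y x) (p : ℕ × S) (m n : ℕ) :
    carryIter p (m + n + 1) = carryAdd (carryIter p m) (carryIter p n) := by
  induction n with
  | zero => rfl
  | succ n ih =>
    rw [← Nat.add_assoc, carryIter, ih, carryIter, carryAdd_assoc htot]

lemma carryIter_carryAdd (htot : ∀ x y : S, le x y ∨ le y x) (p q : ℕ × S) (n : ℕ) :
    carryIter (carryAdd p q) n = carryAdd (carryIter p n) (carryIter q n) := by
  induction n with
  | zero => rfl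
  | succ n ih =>
    rw [carryIter, carryIter, carryIter, ih, carryAdd_assoc htot, carryAdd_assoc htot,
      ← carryAdd_assoc htot _ p q, ← carryAdd_assoc htot p, carryAdd_comm _ p]

lemma carryAdd_fst (p q : ℕ × S) :
    p.1 + q.1 ≤ (carryAdd p q).1 ∧ (carryAdd p q).1 ≤ p.1 + q.1 + 1 := by
  by_cases h : p.2 ⊕ₘ q.2 = one
  · rw [carryAdd_pos h]; exact ⟨Nat.le_succ _, _root_.le_refl _⟩
  · rw [carryAdd_neg h]; exact ⟨_root_.le_refl _, Nat.le_succ _⟩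

lemma carryIter_shift (k : ℕ) (z : S) (n : ℕ) :
    carryIter (k, z) n = ((n + 1) * k + (carryIter (0, z) n).1, (carryIter (0, z) n).2) := by
  induction n with
  | zero => simp [carryIter]
  | succ n ih =>
    rw [carryIter, carryIter, ih]
    by_cases h : (carryIter (0, z) n).2 ⊕ₘ z = one
    · rw [carryAdd_pos h, carryAdd_pos h]
      simp only [Prod.mk.injEq, and_true]
      ring
    · rw [carryAdd_neg h, carryAdd_neg h]
      simp only [Prod.mk.injEq, and_true]
      ring

/-- The integral part of `n x`, plus one. -/
noncomputable def carryCount (x : S) : ℕ → ℝ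
  | 0 => 1
  | n + 1 => ((carryIter (0, x) n).1 : ℝ) + 1

lemma carryCount_nonneg (x : S) (n : ℕ) : 0 ≤ carryCount x n := by
  cases n with
  | zero => exact zero_le_one
  | succ n => rw [carryCount]; positivity

lemma carryCount_subadditive (htot : ∀ x y : S, le x y ∨ le y x) (x : S) :
    Subadditive (carryCount x) := by
  intro m n
  rcases m with _ | m
  · rw [Nat.zero_add, carryCount]; linarith
  rcases n with _ | n
  · simp only [carryCount]; linarith
  have h := (carryAdd_fst (carryIter (0, x) m) (carryIter (0, x) n)).2
  rw [← carryIter_add htot] at h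
  have h' : ((carryIter (0, x) (m + n + 1)).1 : ℝ) ≤
      (carryIter (0, x) m).1 + (carryIter (0, x) n).1 + 1 := by exact_mod_cast h
  rw [show m + 1 + (n + 1) = (m + n + 1) + 1 by ring, carryCount, carryCount, carryCount]
  linarith

/-- The asymptotic slope is additive with respect to `carryAdd`. -/
lemma slope_additive (htot : ∀ x y : S, le x y ∨ le y x) {l : S → ℝ}
    (hl : ∀ x, Filter.Tendsto (fun n : ℕ => carryCount x n / n) Filter.atTop (nhds (l x)))
    {x y z : S} {k : ℕ} (h : carryAdd (0, x) (0, y) = (k, z)) : l x + l y = k + l z := by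
  have h1 := (((hl x).add (hl y)).sub (hl z)).sub_const (k : ℝ)
  have h2 : Filter.Tendsto (fun n : ℕ => carryCount x n / n + carryCount y n / n -
      carryCount z n / n - (k : ℝ)) Filter.atTop (nhds 0) := by
    refine squeeze_zero_norm' ?_ (tendsto_const_div_atTop_nhds_zero_nat (1 : ℝ))
    filter_upwards [Filter.eventually_gt_atTop 0] with n hn
    obtain ⟨n, rfl⟩ := Nat.exists_eq_succ_of_ne_zero hn.ne'
    have e := carryIter_carryAdd htot (0, x) (0, y) n
    rw [h, carryIter_shift] at e
    have hb := carryAdd_fst (carryIter (0, x) n) (carryIter (0, y) n)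
    rw [← e] at hb
    obtain ⟨hb1, hb2⟩ := hb
    have hb1' : ((carryIter (0, x) n).1 + (carryIter (0, y) n).1 : ℝ) ≤
      (n + 1) * k + (carryIter (0, z) n).1 := by exact_mod_cast hb1
    have hb2' : ((n + 1) * k + (carryIter (0, z) n).1 : ℝ) ≤
      (carryIter (0, x) n).1 + (carryIter (0, y) n).1 + 1 := by exact_mod_cast hb2
    have hn' : (0 : ℝ) < ((n + 1 : ℕ) : ℝ) := by positivity
    have e2 : carryCount x (n + 1) / ((n + 1 : ℕ) : ℝ) + carryCount y (n + 1) / ((n + 1 : ℕ) : ℝ) -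
        carryCount z (n + 1) / ((n + 1 : ℕ) : ℝ) - (k : ℝ) =
        (carryCount x (n + 1) + carryCount y (n + 1) - carryCount z (n + 1) - (n + 1 : ℕ) * k) /
          ((n + 1 : ℕ) : ℝ) := by
      field_simp
    rw [Nat.succ_eq_add_one, e2, norm_div, Real.norm_of_nonneg hn'.le]
    gcongr
    rw [Real.norm_eq_abs, abs_le]
    simp only [carryCount]
    push_cast
    constructor <;> linarith
  have := tendsto_nhds_unique h1 h2
  linarith

/-- A nontrivial totally ordered MV-algebra has a homomorphism to `[0, 1]`. -/
lemma exists_hom (htot : ∀ x y : S, le x y ∨ le y x) (h01 : (zero : S) ≠ one) :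
    Nonempty (MVHom S unitInterval) := by
  have hex : ∀ x : S, ∃ a : ℝ,
      Filter.Tendsto (fun n : ℕ => carryCount x n / n) Filter.atTop (nhds a) := fun x =>
    ⟨_, (carryCount_subadditive htot x).tendsto_lim
      ⟨0, by rintro _ ⟨n, rfl⟩; exact div_nonneg (carryCount_nonneg x n) n.cast_nonneg⟩⟩
  choose l hl using hex
  have hpos : ∀ x, 0 ≤ l x := fun x =>
    ge_of_tendsto' (hl x) fun n => div_nonneg (carryCount_nonneg x n) n.cast_nonneg
  have h0 : l zero = 0 := by
    have := slope_additive htot hl (x := zero) (y := zero) (k := 0) (z := zero) (by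
      rw [carryAdd_neg] <;> simp only [oplus_zero]
      exact h01)
    push_cast at this
    linarith
  have h1 : l one = 1 := by
    have := slope_additive htot hl (x := one) (y := one) (k := 1) (z := one) (by
      rw [carryAdd_pos]
      · simp only [odot, neg_one, oplus_zero, neg_zero, Nat.add_zero, Nat.zero_add]
      · exact oplus_one _)
    push_cast at this
    linarith
  have hneg : ∀ x, l x + l (∼ₘx) = 1 := fun x => by
    have := slope_additive htot hl (x := x) (y := ∼ₘx) (k := 1) (z := zero) (by
      rw [carryAdd_pos]
      · simp only [odot, neg_oplus_self, neg_one, neg_neg, Nat.add_zero, Nat.zero_add]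
      · exact oplus_neg_self _)
    push_cast at this
    linarith
  have hle : ∀ x, l x ≤ 1 := fun x => by linarith [hneg x, hpos (∼ₘx)]
  refine ⟨⟨fun x => ⟨l x, hpos x, hle x⟩, Subtype.ext h0, fun x => Subtype.ext ?_,
    fun x y => Subtype.ext ?_⟩⟩
  · change l (∼ₘx) = 1 - l x
    linarith [hneg x]
  · change l (x ⊕ₘ y) = min (l x + l y) 1
    by_cases h : x ⊕ₘ y = one
    · have := slope_additive htot hl (carryAdd_pos (p := (0, x)) (q := (0, y)) h)
      push_cast at this
      rw [h, h1, min_eq_right]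
      linarith [hpos (odot x y)]
    · have := slope_additive htot hl (carryAdd_neg (p := (0, x)) (q := (0, y)) h)
      push_cast at this
      rw [min_eq_left] <;> linarith [hle (x ⊕ₘ y)]

end Chain

end MVAlgebra

namespace MVHom

lemma map_one {A : Type u} {B : Type v} [MVAlgebra A] [MVAlgebra B] (f : MVHom A B) :
    f one = one := by rw [one, f.map_neg, f.map_zero]; rfl

lemma map_odot {A : Type u} {B : Type v} [MVAlgebra A] [MVAlgebra B] (f : MVHom A B) (x y : A) :
    f (odot x y) = odot (f x) (f y) := by
  rw [odot, f.map_neg, f.map_oplus, f.map_neg, f.map_neg]; rfl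

end MVHom

lemma unitInterval.coe_mvone : ((one : unitInterval) : ℝ) = 1 := by
  rw [one, unitInterval.coe_mvneg, unitInterval.coe_mvzero, sub_zero]

lemma unitInterval.coe_odot (x y : unitInterval) :
    ((odot x y : unitInterval) : ℝ) = max (x + y - 1 : ℝ) 0 := by
  rw [odot, unitInterval.coe_mvneg, unitInterval.coe_oplus, unitInterval.coe_mvneg,
    unitInterval.coe_mvneg]
  grind

namespace MVHom

variable {S : Type u} [MVAlgebra S]

lemma map_carryAdd (htot : ∀ x y : S, le x y ∨ le y x) (f : MVHom S unitInterval) (p q : ℕ × S) :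
    ((carryAdd p q).1 + f (carryAdd p q).2 : ℝ) = (p.1 + f p.2) + (q.1 + f q.2) := by
  by_cases h : p.2 ⊕ₘ q.2 = one
  · rw [carryAdd_pos h]
    have h1 : (f (p.2 ⊕ₘ q.2) : ℝ) = 1 := by rw [h, f.map_one, unitInterval.coe_mvone]
    rw [f.map_oplus, unitInterval.coe_oplus] at h1
    simp only [f.map_odot, unitInterval.coe_odot]
    push_cast
    grind
  · rw [carryAdd_neg h]
    have h1 : (f (odot p.2 q.2) : ℝ) = 0 := by
      rw [odot_eq_zero_of_ne htot h, f.map_zero, unitInterval.coe_mvzero]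
    rw [f.map_odot, unitInterval.coe_odot] at h1
    simp only [f.map_oplus, unitInterval.coe_oplus]
    push_cast
    grind

lemma map_carryIter (htot : ∀ x y : S, le x y ∨ le y x) (f : MVHom S unitInterval) (p : ℕ × S)
    (n : ℕ) : ((carryIter p n).1 + f (carryIter p n).2 : ℝ) = (n + 1) * (p.1 + f p.2) := by
  induction n with
  | zero => simp [carryIter]
  | succ n ih =>
    rw [carryIter, map_carryAdd htot, ih]
    push_cast
    ring

/-- A totally ordered MV-algebra has at most one homomorphism to `[0, 1]`. -/
lemma eq_of_chain (htot : ∀ x y : S, le x y ∨ le y x) (f g : MVHom S unitInterval) : f = g := by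
  have key : ∀ (f g : MVHom S unitInterval) (x : S), (f x : ℝ) ≤ g x := by
    intro f g x
    by_contra! hlt
    obtain ⟨n, hn⟩ := exists_nat_gt (1 / ((f x : ℝ) - g x))
    rw [div_lt_iff₀ (by linarith)] at hn
    have h1 := map_carryIter htot f (0, x) n
    have h2 := map_carryIter htot g (0, x) n
    have h3 := (f (carryIter (0, x) n).2).2.2
    have h4 := (g (carryIter (0, x) n).2).2.1
    push_cast at h1 h2
    nlinarith
  refine MVHom.ext (funext fun x => Subtype.ext (_root_.le_antisymm (key f g x) (key g f x)))

end MVHom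

/-! ### The evaluation map -/

/-- For every maximal ideal `m` there is exactly one homomorphism `A / m → [0, 1]`. -/
theorem MVIdeal.existsUnique_hom {A : Type u} [MVAlgebra A] {m : MVIdeal A} (hm : m.IsMaximal) :
    ∃! _h : MVHom m.Quot unitInterval, True :=
  let ⟨h⟩ := exists_hom (MVIdeal.quot_le_total hm) (MVIdeal.quot_zero_ne_one hm)
  ⟨h, trivial, fun _ _ => MVHom.eq_of_chain (MVIdeal.quot_le_total hm) _ _⟩

namespace MaxSpec

variable {A : Type u} [MVAlgebra A]

/-- The unique homomorphism `A / m → [0, 1]`. -/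
noncomputable def holderHom (m : MaxSpec A) : MVHom m.1.Quot unitInterval :=
  (MVIdeal.existsUnique_hom m.2).choose

/-- `â(m)`, the image of `a / m` in `[0, 1]`. -/
noncomputable def hat (a : A) (m : MaxSpec A) : unitInterval := holderHom m (m.1.cls a)

lemma hat_zero (m : MaxSpec A) : hat zero m = zero := (holderHom m).map_zero

lemma hat_neg (a : A) (m : MaxSpec A) : hat (∼ₘa) m = ∼ₘ(hat a m) := (holderHom m).map_neg (m.1.cls a)

lemma hat_oplus (a b : A) (m : MaxSpec A) : hat (a ⊕ₘ b) m = hat a m ⊕ₘ hat b m :=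
  (holderHom m).map_oplus (m.1.cls a) (m.1.cls b)

lemma hat_odot (a b : A) (m : MaxSpec A) : hat (odot a b) m = odot (hat a m) (hat b m) := by
  simp only [odot, hat_neg, hat_oplus]

lemma hat_eq_zero_iff (a : A) (m : MaxSpec A) : (hat a m : ℝ) = 0 ↔ a ∈ m.1.carrier := by
  have hmem : ∀ x ∈ m.1.carrier, (hat x m : ℝ) = 0 := fun x hx => by
    rw [hat, (m.1.cls_eq_zero_iff x).2 hx, (holderHom m).map_zero, unitInterval.coe_mvzero]
  let J : MVIdeal A :=
    { carrier := {x | (hat x m : ℝ) = 0}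
      zero_mem := hmem _ m.1.zero_mem
      mem_of_le := by
        intro x y h hy
        have h1 := hat_oplus x (ominus y x) m
        rw [oplus_ominus_of_le h] at h1
        have h2 := congrArg (fun t : unitInterval => (t : ℝ)) h1
        simp only [unitInterval.coe_oplus] at h2
        have h3 := (hat x m).2.1
        have h4 := (hat (ominus y x) m).2.1
        change (hat y m : ℝ) = 0 at hy
        change (hat x m : ℝ) = 0
        grind
      oplus_mem := by
        intro x y hx hy
        change (hat x m : ℝ) = 0 at hx
        change (hat y m : ℝ) = 0 at hy
        change (hat (x ⊕ₘ y) m : ℝ) = 0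
        rw [hat_oplus, unitInterval.coe_oplus, hx, hy]
        norm_num }
  have hJ : J.carrier ≠ Set.univ := by
    intro h
    have h1 : (one : A) ∈ J.carrier := h ▸ Set.mem_univ _
    have h2 : (hat (one : A) m : ℝ) = 0 := h1
    rw [one, hat_neg, hat_zero, unitInterval.coe_mvneg, unitInterval.coe_mvzero] at h2
    norm_num at h2
  have := m.2.2 J hJ hmem
  exact Set.ext_iff.1 this a

lemma isClosed_V (I : MVIdeal A) : IsClosed (V I.carrier) :=
  ⟨show ∃ J : MVIdeal A, (V I.carrier)ᶜᶜ = V J.carrier from ⟨I, compl_compl _⟩⟩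

lemma isClosed_hat_eq_zero (a : A) : IsClosed {m : MaxSpec A | (hat a m : ℝ) = 0} := by
  let I : MVIdeal A :=
    { carrier := {w | ∃ n, le w (nmul a n)}
      zero_mem := ⟨0, le_refl _⟩
      mem_of_le := by rintro x y hxy ⟨n, h⟩; exact ⟨n, le_trans hxy h⟩
      oplus_mem := by
        rintro x y ⟨n, h⟩ ⟨k, h'⟩
        exact ⟨n + k, by rw [nmul_add]; exact oplus_le h h'⟩ }
  have : {m : MaxSpec A | (hat a m : ℝ) = 0} = V I.carrier := by
    ext m
    rw [Set.mem_ofPred_eq, hat_eq_zero_iff]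
    refine ⟨fun h w => ?_, fun h => h ⟨1, le_oplus_left a zero⟩⟩
    rintro ⟨n, hn⟩
    refine m.1.mem_of_le hn ?_
    clear hn
    induction n with
    | zero => exact m.1.zero_mem
    | succ n ih => exact m.1.oplus_mem ih h
  rw [this]
  exact isClosed_V I

lemma isClosed_hat_le (n : ℕ) : ∀ (k : ℕ) (a : A), k < 2 ^ n →
    IsClosed {m : MaxSpec A | (hat a m : ℝ) * 2 ^ n ≤ k} := by
  induction n with
  | zero =>
    intro k a hk
    obtain rfl : k = 0 := by simpa using hk
    convert isClosed_hat_eq_zero a using 3 with m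
    have := (hat a m).2.1
    simp only [pow_zero, mul_one, Nat.cast_zero]
    exact ⟨fun h => _root_.le_antisymm h this, fun h => h.le⟩
  | succ n ih =>
    intro k a hk
    have hp : (0 : ℝ) < 2 ^ n := by positivity
    by_cases hk2 : k < 2 ^ n
    · convert ih k (a ⊕ₘ a) hk2 using 3 with m
      rw [hat_oplus, unitInterval.coe_oplus, min_mul_of_nonneg _ _ hp.le]
      have : (k : ℝ) < 2 ^ n := by exact_mod_cast hk2
      rw [pow_succ, min_le_iff]
      constructor
      · intro h; left; linarith
      · rintro (h | h) <;> linarith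
    · push Not at hk2
      obtain ⟨j, rfl⟩ := Nat.exists_eq_add_of_le hk2
      convert ih j (odot a a) (by rw [pow_succ] at hk; omega) using 3 with m
      rw [hat_odot, unitInterval.coe_odot, max_mul_of_nonneg _ _ hp.le, max_le_iff]
      have : (0 : ℝ) ≤ j := j.cast_nonneg
      rw [pow_succ]
      push_cast
      constructor
      · intro h; constructor <;> linarith
      · intro h; linarith [h.1]

lemma isOpen_lt_hat (a : A) (c : ℝ) : IsOpen {m : MaxSpec A | c < hat a m} := by
  by_cases hc : c < 0
  · convert isOpen_univ
    rw [Set.eq_univ_iff_forall]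
    exact fun m => lt_of_lt_of_le hc (hat a m).2.1
  push Not at hc
  rw [isOpen_iff_forall_mem_open]
  intro m hm
  change c < hat a m at hm
  obtain ⟨n, hn⟩ := pow_unbounded_of_one_lt (1 / ((hat a m : ℝ) - c)) one_lt_two
  rw [div_lt_iff₀ (by linarith)] at hn
  have hp : (0 : ℝ) < 2 ^ n := by positivity
  set k := ⌊c * 2 ^ n⌋₊ + 1 with hk
  have hk1 : c * 2 ^ n < k := by rw [hk]; push_cast; exact Nat.lt_floor_add_one _
  have hk2 : (k : ℝ) < hat a m * 2 ^ n := by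
    have := Nat.floor_le (mul_nonneg hc hp.le)
    rw [hk]; push_cast; nlinarith
  have hk3 : k < 2 ^ n := by
    have h1 := (hat a m).2.2
    have : (k : ℝ) < 2 ^ n := by nlinarith
    exact_mod_cast this
  refine ⟨_, ?_, (isClosed_hat_le n k a hk3).isOpen_compl, ?_⟩
  · intro m' hm'
    simp only [Set.mem_compl_iff, Set.mem_ofPred_eq, not_le] at hm' ⊢
    exact lt_of_mul_lt_mul_right (hk1.trans hm') hp.le
  · simp only [Set.mem_compl_iff, Set.mem_ofPred_eq, not_le]
    exact hk2

lemma continuous_hat (a : A) : Continuous (hat a) := by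
  refine Continuous.subtype_mk (f := fun m => (hat a m : ℝ)) ?_ _
  refine continuous_generateFrom_iff.2 ?_ |> fun h => by
    rw [OrderTopology.topology_eq_generate_intervals (α := ℝ)]; exact h
  rintro s ⟨c, rfl | rfl⟩
  · exact isOpen_lt_hat a c
  · convert isOpen_lt_hat (∼ₘa) (1 - c) using 2
    ext m
    simp only [Set.mem_preimage, Set.mem_Iio, Set.mem_ofPred_eq, hat_neg, unitInterval.coe_mvneg]
    constructor <;> intro h <;> linarith

end MaxSpec

/-- The evaluation homomorphism `η_A : A → C(Max A)`, `a ↦ â`. -/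
noncomputable def evalHom (A : Type u) [MVAlgebra A] : MVHom A C(MaxSpec A, unitInterval) where
  toFun a := ⟨MaxSpec.hat a, MaxSpec.continuous_hat a⟩
  map_zero := ContinuousMap.ext fun m => MaxSpec.hat_zero m
  map_neg a := ContinuousMap.ext fun m => MaxSpec.hat_neg a m
  map_oplus a b := ContinuousMap.ext fun m => MaxSpec.hat_oplus a b m

/-! ### `δ`-algebras -/

/-- The sequence `x, y₁, y₂, …`. -/
def seqCons {A : Type u} (x : A) (y : ℕ → A) : ℕ → A
  | 0 => x
  | n + 1 => y n

/-- `δ`-algebras. The argument `x₁, x₂, …` of `δ` is indexed from `0`: `x₁` is `x 0`. -/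
class DeltaAlgebra (A : Type u) extends MVAlgebra A where
  delta : (ℕ → A) → A
  /-- `d(δ(x₁, x₂, …), δ(x₁, 0, 0, …)) = δ(0, x₂, x₃, …)` -/
  delta_A1 : ∀ x : ℕ → A, cdist (delta x) (delta (seqCons (x 0) fun _ => zero)) =
    delta (seqCons zero fun n => x (n + 1))
  /-- `f(δ(x₁, x₂, …)) = δ(f(x₁), f(x₂), …)`, where `f(x) = δ(x, 0, 0, …)` -/
  delta_A2 : ∀ x : ℕ → A, delta (seqCons (delta x) fun _ => zero) =
    delta fun n => delta (seqCons (x n) fun _ => zero)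
  /-- `δ(x, x, …) = x` -/
  delta_A3 : ∀ x : A, delta (fun _ => x) = x
  /-- `δ(0, x₁, x₂, …) = f(δ(x₁, x₂, …))` -/
  delta_A4 : ∀ x : ℕ → A, delta (seqCons zero x) = delta (seqCons (delta x) fun _ => zero)
  /-- `δ(x₁ ⊕ y₁, x₂ ⊕ y₂, …) ≥ δ(x₁, x₂, …)` -/
  delta_A5 : ∀ x y : ℕ → A, le (delta x) (delta fun n => x n ⊕ₘ y n)
  /-- `f(x ⊖ y) = f(x) ⊖ f(y)` -/
  delta_A6 : ∀ x y : A, delta (seqCons (ominus x y) fun _ => zero) =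
    ominus (delta (seqCons x fun _ => zero)) (delta (seqCons y fun _ => zero))

/-- Homomorphisms of `δ`-algebras. -/
@[ext]
structure DeltaHom (A : Type u) (B : Type v) [DeltaAlgebra A] [DeltaAlgebra B]
    extends MVHom A B where
  map_delta : ∀ x : ℕ → A, toFun (DeltaAlgebra.delta x) = DeltaAlgebra.delta fun n => toFun (x n)

/-! ### Categories -/

/-- The category `MV` of MV-algebras. -/
structure MVCat : Type (u + 1) where
  carrier : Type u
  [str : MVAlgebra carrier]

attribute [instance] MVCat.str

instance : Category MVCat.{u} where
  Hom A B := MVHom A.carrier B.carrier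
  id A := MVHom.id A.carrier
  comp f g := g.comp f

/-- The category `VA` of `δ`-algebras. -/
structure DeltaCat : Type (u + 1) where
  carrier : Type u
  [str : DeltaAlgebra carrier]

attribute [instance] DeltaCat.str

instance : Category DeltaCat.{u} where
  Hom A B := DeltaHom A.carrier B.carrier
  id A := { MVHom.id A.carrier with map_delta := fun _ => rfl }
  comp f g := { g.toMVHom.comp f.toMVHom with
    map_delta := fun x => by
      change g.toFun (f.toFun _) = _
      rw [f.map_delta, g.map_delta]
      rfl }

/-- The forgetful functor sending a `δ`-algebra to its underlying MV-algebra. -/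
def forgetDelta : DeltaCat.{u} ⥤ MVCat.{u} where
  obj A := ⟨A.carrier⟩
  map f := f.toMVHom

/-- The component `η_A : A ⟶ C(Max A)` of the evaluation, as an arrow of `MV`. -/
noncomputable def etaMV (A : MVCat.{u}) : A ⟶ MVCat.mk C(MaxSpec A.carrier, unitInterval) :=
  evalHom A.carrier

/-- The (object property defining the) full subcategory of `MV` on the objects in the image of the
forgetful functor from `δ`-algebras. -/
def deltaReducts : ObjectProperty MVCat.{u} := fun A => ∃ B : DeltaCat.{u}, forgetDelta.obj B = A

/-- The (object property defining the) full subcategory `MV_C` of `MV` on the MV-algebras `A` such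
that `η_A` is an isomorphism. -/
def fixedByEta : ObjectProperty MVCat.{u} := fun A => IsIso (etaMV A)

/-!
The guiding picture is that `δ(x₁, x₂, …)` is the sum `∑ xₙ / 2ⁿ`, and that `f` is division by `2`.

If `η_A` is bijective, this sum, which converges uniformly on `Max A`, is transported from
`C(Max A)` to `A`. Since the homomorphisms `a ↦ η_A(a)(m)` are jointly injective, the identities
need only be checked in `[0, 1]` (`DeltaAlgebra.ofSeparating`).

Conversely, let `A` be a `δ`-algebra. The identities yield `x = f(x) ⊕ f(x)`, `¬f(1) = f(1)` and
`δ(x₁, x₂, …) = f(x₁) ⊕ f(δ(x₂, …))`, so that under evaluation at a maximal ideal `f` becomes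
division by `2` and `δ` becomes the sum above (`DeltaAlgebra.hat_half`, `DeltaAlgebra.hat_delta`).

* `η_A` is injective. Its kernel consists of the elements `e` of all maximal ideals; these are
  infinitesimal, as are their multiples, hence `y = δ(2e, 4e, 8e, …)` absorbs `e`, in the sense that
  `y ⊖ e = y`. As `e ≤ y`, this forces `e = 0` (`DeltaAlgebra.eq_zero_of_forall_mem`).
* `η_A` is surjective. The space `Max A` is compact, `A` separates its points, and the constant
  `1 / 4` lies in the image, so every continuous `g` is within `1 / 4` of the image by the lattice
  argument of the Stone–Weierstrass theorem (`MaxSpec.exists_hat_near`). This is enough to split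
  off a binary digit, writing `g = x / 2 + g' / 2` with `x` in the image and `g'` continuous with
  values in `[0, 1]` (`DeltaAlgebra.exists_digit`). Iterating gives `g = ∑ xₙ / 2ⁿ`, which is the
  evaluation of `δ(x₁, x₂, …)`.
-/

/-! ### Maximal ideals and compactness of the maximal spectrum -/

namespace MVIdeal

variable {A : Type u} [MVAlgebra A]

/-- Every proper ideal lies in a maximal ideal. -/
lemma exists_le_maximal (I : MVIdeal A) (hI : I.carrier ≠ Set.univ) :
    ∃ m : MaxSpec A, I.carrier ⊆ m.1.carrier := by
  obtain ⟨M, hIM, hM⟩ := zorn_subset_nonempty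
    {s : Set A | ∃ J : MVIdeal A, J.carrier = s ∧ one ∉ J.carrier} (by
      rintro c hc hchain ⟨s₀, hs₀⟩
      refine ⟨⋃₀ c, ⟨⟨⋃₀ c, ?_, ?_, ?_⟩, rfl, ?_⟩, fun s hs => Set.subset_sUnion_of_mem hs⟩
      · obtain ⟨J, rfl, -⟩ := hc hs₀
        exact ⟨_, hs₀, J.zero_mem⟩
      · rintro x y hxy ⟨s, hs, hy⟩
        obtain ⟨J, rfl, -⟩ := hc hs
        exact ⟨_, hs, J.mem_of_le hxy hy⟩
      · rintro x y ⟨s, hs, hx⟩ ⟨t, ht, hy⟩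
        rcases hchain.total hs ht with h | h
        · obtain ⟨J, rfl, -⟩ := hc ht
          exact ⟨_, ht, J.oplus_mem (h hx) hy⟩
        · obtain ⟨J, rfl, -⟩ := hc hs
          exact ⟨_, hs, J.oplus_mem hx (h hy)⟩
      · rintro ⟨s, hs, h⟩
        obtain ⟨J, rfl, hJ⟩ := hc hs
        exact hJ h) I.carrier ⟨I, rfl, one_notMem hI⟩
  obtain ⟨J, rfl, hJ⟩ := hM.prop
  exact ⟨⟨J, fun h => hJ (h ▸ Set.mem_univ _), fun K hK hJK =>
    Set.Subset.antisymm (hM.le_of_ge ⟨K, rfl, one_notMem hK⟩ hJK) hJK⟩, hIM⟩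

/-- The polar `{x | x ∧ w = 0}` of an element `w`. -/
def polar (w : A) : MVIdeal A where
  carrier := {x | ∀ z, le z x → le z w → z = zero}
  zero_mem := fun _ h _ => eq_zero_of_le h
  mem_of_le := fun h hy z hz => hy z (le_trans hz h)
  oplus_mem := by
    intro x y hx hy z hz hw
    have h : ominus z x = zero :=
      hy _ (ominus_le_iff.2 hz) (le_trans (ominus_le_self _ _) hw)
    exact hx z (ominus_eq_zero_iff.1 h) hw

end MVIdeal

namespace MaxSpec

variable {A : Type u} [MVAlgebra A]

/-- An element of all maximal ideals is infinitesimal. The polar of `u ⊙ u = u ⊖ ¬u` contains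
`¬u ⊖ u`, hence a maximal ideal containing it and `u` would contain `¬u`, too. -/
lemma le_neg_of_forall_mem {u : A} (hu : ∀ m : MaxSpec A, u ∈ m.1.carrier) : le u (∼ₘu) := by
  rw [← ominus_eq_zero_iff]
  by_contra hw
  obtain ⟨m, hm⟩ := (MVIdeal.polar (ominus u (∼ₘu))).exists_le_maximal (fun h => hw <| by
    have h1 : one ∈ (MVIdeal.polar (ominus u (∼ₘu))).carrier := h ▸ Set.mem_univ _
    exact h1 _ (le_one _) (le_refl _))
  have h1 : ominus (∼ₘu) u ∈ m.1.carrier := hm fun z hz hz' => eq_zero_of_le_ominus hz' hz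
  have h2 : ∼ₘu ∈ m.1.carrier :=
    m.1.mem_of_le (le_oplus_ominus (∼ₘu) u) (m.1.oplus_mem (hu m) h1)
  exact MVIdeal.one_notMem m.2.1 (oplus_neg_self u ▸ m.1.oplus_mem (hu m) h2)

/-- An ultrafilter `U` on `Max A` converges to every maximal ideal that contains the ideal of the
elements lying in `U`-almost all maximal ideals. -/
instance : CompactSpace (MaxSpec A) where
  isCompact_univ := by
    rw [isCompact_iff_ultrafilter_le_nhds]
    intro U _
    let I : MVIdeal A :=
      { carrier := {a | ∀ᶠ m : MaxSpec A in U, a ∈ m.1.carrier}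
        zero_mem := Filter.Eventually.of_forall fun m => m.1.zero_mem
        mem_of_le := fun h hy => hy.mono fun m hm => m.1.mem_of_le h hm
        oplus_mem := fun hx hy => (hx.and hy).mono fun m hm => m.1.oplus_mem hm.1 hm.2 }
    have hI : I.carrier ≠ Set.univ := by
      intro h
      have h1 : one ∈ I.carrier := h ▸ Set.mem_univ _
      obtain ⟨m, hm⟩ := Filter.Eventually.exists (f := (U : Filter (MaxSpec A))) h1
      exact MVIdeal.one_notMem m.2.1 hm
    obtain ⟨m, hm⟩ := I.exists_le_maximal hI
    refine ⟨m, Set.mem_univ _, le_nhds_iff.2 fun s hms hs => ?_⟩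
    by_contra hsU
    obtain ⟨J, hJ⟩ : ∃ J : MVIdeal A, sᶜ = V J.carrier := hs
    have hJU : V J.carrier ∈ U := hJ ▸ Ultrafilter.compl_mem_iff_notMem.2 hsU
    have : m ∈ sᶜ := by
      rw [hJ]
      exact fun a ha => hm (Filter.mem_of_superset hJU fun m' hm' => hm' ha)
    exact this hms

lemma hat_ominus (a b : A) (m : MaxSpec A) :
    (hat (ominus a b) m : ℝ) = max (hat a m - hat b m : ℝ) 0 := by
  rw [ominus, hat_odot, unitInterval.coe_odot, hat_neg, unitInterval.coe_mvneg]
  congr 1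
  ring

lemma hat_one (m : MaxSpec A) : (hat (one : A) m : ℝ) = 1 := by
  rw [one, hat_neg, unitInterval.coe_mvneg, hat_zero, unitInterval.coe_mvzero, sub_zero]

lemma hat_nmul (a : A) (n : ℕ) (m : MaxSpec A) :
    (hat (nmul a n) m : ℝ) = min (n * hat a m : ℝ) 1 := by
  induction n with
  | zero => simp [nmul, hat_zero, unitInterval.coe_mvzero]
  | succ n ih =>
    have := (hat a m).2.1
    rw [nmul, hat_oplus, unitInterval.coe_oplus, ih]
    push_cast
    grind

lemma exists_hat_eq_sup (a b : A) : ∃ c : A, ∀ m, (hat c m : ℝ) = max (hat a m : ℝ) (hat b m) := by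
  refine ⟨b ⊕ₘ ominus a b, fun m => ?_⟩
  have := (hat a m).2
  have := (hat b m).2
  rw [hat_oplus, unitInterval.coe_oplus, hat_ominus]
  grind

lemma exists_hat_eq_inf (a b : A) : ∃ c : A, ∀ m, (hat c m : ℝ) = min (hat a m : ℝ) (hat b m) := by
  refine ⟨ominus a (ominus a b), fun m => ?_⟩
  have := (hat a m).2
  have := (hat b m).2
  rw [hat_ominus, hat_ominus]
  grind

/-- Distinct maximal ideals are separated by elements taking the values `0` and `1`. -/
lemma exists_hat_eq_zero_one {p q : MaxSpec A} (h : p ≠ q) :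
    ∃ a : A, (hat a p : ℝ) = 0 ∧ (hat a q : ℝ) = 1 := by
  have hpq : ¬ p.1.carrier ⊆ q.1.carrier := fun hs =>
    h (Subtype.ext (MVIdeal.ext (p.2.2 q.1 q.2.1 hs).symm))
  obtain ⟨a, hap, haq⟩ := Set.not_subset.1 hpq
  rw [← hat_eq_zero_iff] at hap haq
  have h0 : (0 : ℝ) < hat a q := lt_of_le_of_ne (hat a q).2.1 (Ne.symm haq)
  obtain ⟨n, hn⟩ := exists_nat_gt (1 / (hat a q : ℝ))
  rw [div_lt_iff₀ h0] at hn
  exact ⟨nmul a n, by rw [hat_nmul, hap]; simp, by rw [hat_nmul, min_eq_right hn.le]⟩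

/-- A lattice form of the Stone–Weierstrass theorem: if an element of `A` evaluates to the constant
`1 / 4`, then every continuous function is uniformly approximated with error `1 / 4` by an element
of `A`. Only two-point interpolation with this error is needed: the values `0` and `1`
serve at distinct points, and the multiples of `1 / 4` at a single point. -/
lemma exists_hat_near {c : A} (hc : ∀ m : MaxSpec A, (hat c m : ℝ) = 1 / 4)
    (g : C(MaxSpec A, unitInterval)) :
    ∃ a : A, ∀ m, (g m : ℝ) - 1 / 4 < hat a m ∧ (hat a m : ℝ) < g m + 1 / 4 := by
  have hcont : ∀ a : A, Continuous fun m : MaxSpec A => (hat a m : ℝ) := fun a =>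
    continuous_subtype_val.comp (continuous_hat a)
  have hgcont : Continuous fun m : MaxSpec A => (g m : ℝ) :=
    continuous_subtype_val.comp g.continuous
  have two : ∀ p q : MaxSpec A, ∃ a : A, (hat a p : ℝ) < g p + 1 / 4 ∧
      (g q : ℝ) - 1 / 4 < hat a q := by
    intro p q
    have := (g p).2
    have := (g q).2
    by_cases h : p = q
    · subst h
      refine ⟨nmul c ⌊4 * (g p : ℝ)⌋₊, ?_⟩
      have h1 := Nat.floor_le (show 0 ≤ 4 * (g p : ℝ) by linarith [(g p).2.1])
      have h2 := Nat.lt_floor_add_one (4 * (g p : ℝ))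
      rw [hat_nmul, hc, min_eq_left (by linarith [(g p).2.2])]
      constructor <;> linarith
    · obtain ⟨a, h0, h1⟩ := exists_hat_eq_zero_one h
      exact ⟨a, by rw [h0]; linarith [(g p).2.1], by rw [h1]; linarith [(g q).2.2]⟩
  have upper : ∀ p : MaxSpec A, ∃ a : A, (hat a p : ℝ) < g p + 1 / 4 ∧
      ∀ q, (g q : ℝ) - 1 / 4 < hat a q := by
    intro p
    have := isCompact_univ.induction_on (X := MaxSpec A)
      (p := fun s => ∃ a : A, (hat a p : ℝ) < g p + 1 / 4 ∧ ∀ q ∈ s, (g q : ℝ) - 1 / 4 < hat a q)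
      ⟨zero, by rw [hat_zero, unitInterval.coe_mvzero]; linarith [(g p).2.1], by simp⟩
      (fun s t hst ⟨a, ha, h⟩ => ⟨a, ha, fun q hq => h q (hst hq)⟩)
      (by
        rintro s t ⟨a, ha, h⟩ ⟨b, hb, h'⟩
        obtain ⟨d, hd⟩ := exists_hat_eq_sup a b
        refine ⟨d, by rw [hd]; exact max_lt ha hb, ?_⟩
        rintro q (hq | hq) <;> rw [hd]
        · exact lt_max_of_lt_left (h q hq)
        · exact lt_max_of_lt_right (h' q hq))
      (by
        intro q _
        obtain ⟨a, ha, h⟩ := two p q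
        exact ⟨{m | (g m : ℝ) - 1 / 4 < hat a m}, mem_nhdsWithin_of_mem_nhds
          ((isOpen_lt (hgcont.sub continuous_const) (hcont a)).mem_nhds h), a, ha, fun _ h => h⟩)
    obtain ⟨a, ha, h⟩ := this
    exact ⟨a, ha, fun q => h q (Set.mem_univ q)⟩
  have := isCompact_univ.induction_on (X := MaxSpec A)
    (p := fun s => ∃ a : A, (∀ q, (g q : ℝ) - 1 / 4 < hat a q) ∧
      ∀ q ∈ s, (hat a q : ℝ) < g q + 1 / 4)
    ⟨one, fun q => by rw [hat_one]; linarith [(g q).2.2], by simp⟩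
    (fun s t hst ⟨a, ha, h⟩ => ⟨a, ha, fun q hq => h q (hst hq)⟩)
    (by
      rintro s t ⟨a, ha, h⟩ ⟨b, hb, h'⟩
      obtain ⟨d, hd⟩ := exists_hat_eq_inf a b
      refine ⟨d, fun q => by rw [hd]; exact lt_min (ha q) (hb q), ?_⟩
      rintro q (hq | hq) <;> rw [hd]
      · exact min_lt_of_left_lt (h q hq)
      · exact min_lt_of_right_lt (h' q hq))
    (by
      intro p _
      obtain ⟨a, ha, h⟩ := upper p
      exact ⟨{m | (hat a m : ℝ) < g m + 1 / 4}, mem_nhdsWithin_of_mem_nhds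
        ((isOpen_lt (hcont a) (hgcont.add continuous_const)).mem_nhds ha), a, h, fun _ h => h⟩)
  obtain ⟨a, ha, h⟩ := this
  exact ⟨a, fun m => ⟨ha m, h m (Set.mem_univ m)⟩⟩

end MaxSpec

/-! ### Halving and infinitesimals in `δ`-algebras -/

lemma apply_seqCons {A : Type u} {B : Type v} (φ : A → B) (x : A) (y : ℕ → A) :
    (fun n => φ (seqCons x y n)) = seqCons (φ x) fun n => φ (y n) := by
  funext n
  cases n <;> rfl

namespace DeltaAlgebra

variable {A : Type u} [DeltaAlgebra A]

/-- The operation `f(x) = δ(x, 0, 0, …)`, to be thought of as `x ↦ x / 2`. -/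
def half (x : A) : A := delta (seqCons x fun _ => zero)

lemma delta_le_delta {x y : ℕ → A} (h : ∀ n, le (x n) (y n)) : le (delta x) (delta y) := by
  have := delta_A5 x fun n => ominus (y n) (x n)
  simpa only [oplus_ominus_of_le (h _)] using this

lemma half_le_half {x y : A} (h : le x y) : le (half x) (half y) := by
  refine delta_le_delta fun n => ?_
  cases n
  · exact h
  · exact le_refl _

lemma half_le_delta (x : ℕ → A) : le (half (x 0)) (delta x) := by
  refine delta_le_delta fun n => ?_
  cases n
  · exact le_refl _
  · exact zero_le _

lemma delta_ominus_half (x : ℕ → A) :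
    ominus (delta x) (half (x 0)) = half (delta fun n => x (n + 1)) := by
  have h : cdist (delta x) (half (x 0)) = half (delta fun n => x (n + 1)) :=
    (delta_A1 x).trans (delta_A4 fun n => x (n + 1))
  rwa [cdist, ominus_eq_zero_iff.2 (half_le_delta x), oplus_zero] at h

lemma delta_eq (x : ℕ → A) : delta x = half (x 0) ⊕ₘ half (delta fun n => x (n + 1)) := by
  rw [← delta_ominus_half, oplus_ominus_of_le (half_le_delta x)]

lemma half_oplus_half (x : A) : half x ⊕ₘ half x = x := by
  have := delta_eq fun _ => x
  rw [delta_A3] at this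
  exact this.symm

/-- The element `f(1)` equals its own negation, so that it evaluates to `1 / 2` everywhere. -/
lemma neg_half_one : ∼ₘ(half (one : A)) = half one := by
  have := delta_ominus_half fun _ => (one : A)
  simp only [delta_A3] at this
  rwa [ominus_eq, neg_one, zero_oplus] at this

/-- On elements with `x ⊙ x = 0`, doubling is undone by `f`. -/
lemma half_oplus_self {x : A} (h : le x (∼ₘx)) : half (x ⊕ₘ x) = x := by
  have h1 : ominus (half (x ⊕ₘ x)) (half x) = half x := by
    rw [half, half, ← delta_A6, oplus_ominus_cancel h]
  rw [← oplus_ominus_of_le (half_le_half (le_oplus_right x x)), h1, half_oplus_half]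

/-- The intersection of the maximal ideals of a `δ`-algebra is `0`: `y = δ(2e, 4e, 8e, …)` satisfies
`y ⊖ e = y`, while `e ≤ y`. -/
lemma eq_zero_of_forall_mem {e : A} (he : ∀ m : MaxSpec A, e ∈ m.1.carrier) : e = zero := by
  let s : ℕ → A := fun n => n.rec e fun _ x => x ⊕ₘ x
  have hs : ∀ (n : ℕ) (m : MaxSpec A), s n ∈ m.1.carrier := by
    intro n m
    induction n with
    | zero => exact he m
    | succ n ih => exact m.1.oplus_mem ih ih
  have hhalf : ∀ n, half (s (n + 1)) = s n := fun n =>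
    half_oplus_self (MaxSpec.le_neg_of_forall_mem (hs n))
  set y : A := delta fun n => s (n + 1) with hy
  have h1 : half (delta fun n => s (n + 2)) = y := by
    rw [hy, half, delta_A2]
    exact congrArg delta (funext fun n => hhalf (n + 1))
  have hey : le e y := by
    have := half_le_delta fun n => s (n + 1)
    rwa [hhalf] at this
  have hsub : ominus y e = y := by
    have := delta_ominus_half fun n => s (n + 1)
    rwa [hhalf, h1] at this
  -- as `e ≤ ¬(y ⊖ e)`, cancellation yields `e = y ⊖ (y ⊖ e)`, which is `y ⊖ y`
  have h2 := oplus_ominus_cancel (le_neg_comm (ominus_le_neg y e))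
  rw [oplus_comm, oplus_ominus_of_le hey, hsub, ominus_self] at h2
  exact h2.symm

lemma hat_injective {a b : A} (h : ∀ m, MaxSpec.hat a m = MaxSpec.hat b m) : a = b := by
  have key : ∀ a b : A, (∀ m, MaxSpec.hat a m = MaxSpec.hat b m) → le a b := by
    intro a b h
    rw [← ominus_eq_zero_iff]
    refine eq_zero_of_forall_mem fun m => ?_
    rw [← MaxSpec.hat_eq_zero_iff, MaxSpec.hat_ominus, h m, sub_self, max_self]
  exact le_antisymm (key a b h) (key b a fun m => (h m).symm)

/-! ### Surjectivity of the evaluation of a `δ`-algebra -/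

lemma hat_half (a : A) (m : MaxSpec A) : (MaxSpec.hat (half a) m : ℝ) = MaxSpec.hat a m / 2 := by
  have h1 : (MaxSpec.hat (half (one : A)) m : ℝ) = 1 / 2 := by
    have := congrArg (fun t => (MaxSpec.hat t m : ℝ)) (neg_half_one (A := A))
    simp only [MaxSpec.hat_neg, unitInterval.coe_mvneg] at this
    linarith
  have h2 := MaxSpec.hat_ominus (half a) (half (one : A)) m
  rw [ominus_eq_zero_iff.2 (half_le_half (le_one a)), MaxSpec.hat_zero, unitInterval.coe_mvzero,
    h1] at h2
  have h3 := congrArg (fun t => (MaxSpec.hat t m : ℝ)) (half_oplus_half a)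
  simp only [MaxSpec.hat_oplus, unitInterval.coe_oplus] at h3
  grind

lemma hat_delta (x : ℕ → A) (m : MaxSpec A) : (MaxSpec.hat (delta x) m : ℝ) =
    MaxSpec.hat (x 0) m / 2 + MaxSpec.hat (delta fun n => x (n + 1)) m / 2 := by
  have h1 := (MaxSpec.hat (x 0) m).2.2
  have h2 := (MaxSpec.hat (delta fun n => x (n + 1)) m).2.2
  rw [delta_eq, MaxSpec.hat_oplus, unitInterval.coe_oplus, hat_half, hat_half,
    min_eq_left (by linarith)]

/-- One step of a binary expansion with digits in the image of `A`. -/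
lemma exists_digit (g : C(MaxSpec A, unitInterval)) :
    ∃ (x : A) (g' : C(MaxSpec A, unitInterval)),
      ∀ m, (g m : ℝ) = MaxSpec.hat x m / 2 + g' m / 2 := by
  have hc : ∀ m : MaxSpec A, (MaxSpec.hat (half (half (one : A))) m : ℝ) = 1 / 4 := fun m => by
    rw [hat_half, hat_half, MaxSpec.hat_one]; norm_num
  obtain ⟨a, ha⟩ := MaxSpec.exists_hat_near hc g
  -- For `|a - g| < 1 / 4`, the truncation `x` of `2 a - 1 / 2` to `[0, 1]` satisfies
  -- `2 g - 1 ≤ x ≤ 2 g`, exactly.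
  set b := ominus a (half (half one)) with hb
  have hx : ∀ m, 0 ≤ 2 * (g m : ℝ) - MaxSpec.hat (b ⊕ₘ b) m ∧
      2 * (g m : ℝ) - MaxSpec.hat (b ⊕ₘ b) m ≤ 1 := by
    intro m
    have h1 := ha m
    have h2 := (g m).2
    rw [MaxSpec.hat_oplus, unitInterval.coe_oplus, hb, MaxSpec.hat_ominus, hc]
    grind
  refine ⟨b ⊕ₘ b, ⟨fun m => ⟨_, hx m⟩, ?_⟩, fun m => ?_⟩
  · refine Continuous.subtype_mk ?_ _
    have := MaxSpec.continuous_hat (b ⊕ₘ b)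
    fun_prop
  · change (g m : ℝ) = MaxSpec.hat (b ⊕ₘ b) m / 2 + (2 * (g m : ℝ) - MaxSpec.hat (b ⊕ₘ b) m) / 2
    ring

/-- Every continuous function `g` is the evaluation of `δ` at the digits of a binary expansion of `g`,
the evaluation of `δ` and the expansion satisfying the same recursion. -/
lemma exists_hat_eq (g : C(MaxSpec A, unitInterval)) : ∃ a : A, ∀ m, MaxSpec.hat a m = g m := by
  choose digit rest hrest using exists_digit (A := A)
  let G : ℕ → C(MaxSpec A, unitInterval) := fun n => rest^[n] g
  have hG : ∀ n, G (n + 1) = rest (G n) := fun n => Function.iterate_succ_apply' rest n g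
  refine ⟨delta fun n => digit (G n), fun m => ?_⟩
  -- the error halves at each step, and stays bounded
  have herr : ∀ n, (MaxSpec.hat (delta fun n => digit (G n)) m : ℝ) - g m =
      (MaxSpec.hat (delta fun k => digit (G (k + n))) m - G n m) / 2 ^ n := by
    intro n
    induction n with
    | zero => simp [G]
    | succ n ih =>
      rw [ih, hat_delta, hrest (G n), hG n]
      simp only [Nat.zero_add, Nat.add_right_comm _ 1 n, Nat.add_assoc]
      field_simp
      ring
  have hbound : ∀ n, |(MaxSpec.hat (delta fun n => digit (G n)) m : ℝ) - g m| ≤ (1 / 2) ^ n := by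
    intro n
    have h1 := (MaxSpec.hat (delta fun k => digit (G (k + n))) m).2
    have h2 := (G n m).2
    rw [herr n, abs_div, abs_of_pos (show (0 : ℝ) < 2 ^ n by positivity), one_div, inv_pow,
      ← one_div]
    gcongr
    rw [abs_le]
    constructor <;> linarith [h1.1, h1.2, h2.1, h2.2]
  have hlim := ge_of_tendsto'
    (tendsto_pow_atTop_nhds_zero_of_lt_one (by norm_num : (0 : ℝ) ≤ 1 / 2) (by norm_num)) hbound
  exact Subtype.ext (sub_eq_zero.1 (abs_nonpos_iff.1 hlim))

lemma evalHom_bijective : Function.Bijective (evalHom A) :=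
  ⟨fun _ _ h => hat_injective fun m => congrArg (fun g => g m) h,
    fun g => (exists_hat_eq g).imp fun _ h => ContinuousMap.ext h⟩

end DeltaAlgebra

/-! ### The `δ`-algebra `[0, 1]`, and `δ`-algebras of `[0, 1]`-valued functions -/

namespace unitInterval

lemma summable_div_pow (x : ℕ → unitInterval) : Summable fun n => (x n : ℝ) / 2 / 2 ^ n :=
  Summable.of_nonneg_of_le (fun n => by have := (x n).2.1; positivity)
    (fun n => by gcongr; exact (x n).2.2) (summable_geometric_two' 1)

lemma tsum_div_pow_mem (x : ℕ → unitInterval) : ∑' n, (x n : ℝ) / 2 / 2 ^ n ∈ unitInterval := by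
  refine ⟨tsum_nonneg fun n => by have := (x n).2.1; positivity, ?_⟩
  rw [← tsum_geometric_two' 1]
  exact (summable_div_pow x).tsum_le_tsum (fun n => by gcongr; exact (x n).2.2)
    (summable_geometric_two' 1)

/-- The standard `δ` on `[0, 1]`, the weighted sum `∑ xₙ / 2ⁿ⁺¹` over `n` starting from `0`. -/
noncomputable def binarySum (x : ℕ → unitInterval) : unitInterval :=
  ⟨∑' n, (x n : ℝ) / 2 / 2 ^ n, tsum_div_pow_mem x⟩

/-- The recursion that determines `binarySum`: it halves the head and the sum of the tail. -/
lemma coe_binarySum (x : ℕ → unitInterval) :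
    (binarySum x : ℝ) = x 0 / 2 + binarySum (fun n => x (n + 1)) / 2 := by
  change ∑' n, (x n : ℝ) / 2 / 2 ^ n = x 0 / 2 + (∑' n, (x (n + 1) : ℝ) / 2 / 2 ^ n) / 2
  rw [(summable_div_pow x).tsum_eq_zero_add, ← tsum_div_const]
  congr 1
  · simp
  · refine tsum_congr fun n => ?_
    rw [pow_succ, div_div _ _ (2 : ℝ)]

lemma binarySum_le {x y : ℕ → unitInterval} (h : ∀ n, (x n : ℝ) ≤ y n) :
    (binarySum x : ℝ) ≤ binarySum y :=
  (summable_div_pow x).tsum_le_tsum (fun n => by gcongr; exact h n) (summable_div_pow y)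

lemma binarySum_half {x y : ℕ → unitInterval} (h : ∀ n, (y n : ℝ) = x n / 2) :
    (binarySum y : ℝ) = binarySum x / 2 := by
  change ∑' n, (y n : ℝ) / 2 / 2 ^ n = (∑' n, (x n : ℝ) / 2 / 2 ^ n) / 2
  rw [← tsum_div_const]
  refine tsum_congr fun n => ?_
  rw [h n]
  ring

lemma binarySum_const (c : unitInterval) : binarySum (fun _ => c) = c := by
  have := coe_binarySum fun _ => c
  exact Subtype.ext (by linarith)

lemma binarySum_seqCons_zero (c : unitInterval) :
    (binarySum (seqCons c fun _ => zero) : ℝ) = c / 2 := by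
  have h := coe_binarySum (seqCons c fun _ => zero)
  simp only [seqCons, binarySum_const, coe_mvzero] at h
  linarith

lemma coe_ominus (x y : unitInterval) : ((ominus x y : unitInterval) : ℝ) = max (x - y : ℝ) 0 := by
  rw [ominus, coe_odot, coe_mvneg]
  congr 1
  ring

lemma le_of_coe_le {x y : unitInterval} (h : (x : ℝ) ≤ y) : MVAlgebra.le x y := by
  rw [← ominus_eq_zero_iff]
  exact Subtype.ext (by rw [coe_ominus, coe_mvzero, max_eq_right (by linarith)])

noncomputable instance : DeltaAlgebra unitInterval where
  delta := binarySum
  delta_A1 x := by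
    apply Subtype.ext
    have h1 := coe_binarySum x
    have h2 := coe_binarySum (seqCons zero fun n => x (n + 1))
    simp only [seqCons, coe_mvzero] at h2
    have := (binarySum fun n => x (n + 1)).2
    rw [cdist, coe_oplus, coe_ominus, coe_ominus, binarySum_seqCons_zero, h1]
    change _ = (binarySum (seqCons zero fun n => x (n + 1)) : ℝ)
    rw [h2]
    grind
  delta_A2 x := by
    apply Subtype.ext
    rw [binarySum_seqCons_zero]
    exact (binarySum_half fun n => binarySum_seqCons_zero (x n)).symm
  delta_A3 := binarySum_const
  delta_A4 x := by
    apply Subtype.ext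
    have h := coe_binarySum (seqCons zero x)
    simp only [seqCons, coe_mvzero] at h
    rw [binarySum_seqCons_zero, h]
    ring
  delta_A5 x y := le_of_coe_le <| binarySum_le fun n => by
    rw [coe_oplus]
    exact le_min (by linarith [(y n).2.1]) (x n).2.2
  delta_A6 x y := by
    apply Subtype.ext
    rw [coe_ominus]
    simp only [binarySum_seqCons_zero]
    rw [coe_ominus]
    grind

lemma continuous_delta {X : Type u} [TopologicalSpace X] (g : ℕ → C(X, unitInterval)) :
    Continuous fun m => DeltaAlgebra.delta fun n => g n m := by
  refine Continuous.subtype_mk (f := fun m => ∑' n, (g n m : ℝ) / 2 / 2 ^ n) ?_ _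
  refine continuous_tsum (fun n => by fun_prop) (summable_geometric_two' 1) fun n m => ?_
  rw [Real.norm_of_nonneg (by have := (g n m).2.1; positivity)]
  gcongr
  exact (g n m).2.2

end unitInterval

namespace MVHom

variable {A : Type u} {B : Type v} [MVAlgebra A] [MVAlgebra B]

lemma map_ominus (φ : MVHom A B) (x y : A) : φ (ominus x y) = ominus (φ x) (φ y) := by
  rw [ominus, φ.map_odot, φ.map_neg]; rfl

lemma map_cdist (φ : MVHom A B) (x y : A) : φ (cdist x y) = cdist (φ x) (φ y) := by
  rw [cdist, φ.map_oplus, φ.map_ominus, φ.map_ominus]; rfl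

/-- The inverse of a bijective homomorphism. -/
noncomputable def inverse (φ : MVHom A B) (h : Function.Bijective φ) : MVHom B A where
  toFun := (Equiv.ofBijective φ h).symm
  map_zero := by rw [Equiv.symm_apply_eq]; exact φ.map_zero.symm
  map_neg x := by
    rw [Equiv.symm_apply_eq]
    change _ = φ _
    rw [φ.map_neg]
    exact congrArg _ ((Equiv.ofBijective φ h).apply_symm_apply x).symm
  map_oplus x y := by
    rw [Equiv.symm_apply_eq]
    change _ = φ _
    rw [φ.map_oplus]
    exact congrArg₂ _ ((Equiv.ofBijective φ h).apply_symm_apply x).symm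
      ((Equiv.ofBijective φ h).apply_symm_apply y).symm

end MVHom

/-- An MV-algebra with an operation preserved by a jointly injective family of homomorphisms to a
`δ`-algebra is a `δ`-algebra. -/
@[reducible]
def DeltaAlgebra.ofSeparating {A : Type u} {B : Type v} {ι : Type*} [MVAlgebra A] [DeltaAlgebra B]
    (φ : ι → MVHom A B) (hφ : ∀ a b : A, (∀ i, φ i a = φ i b) → a = b) (D : (ℕ → A) → A)
    (hD : ∀ i x, φ i (D x) = DeltaAlgebra.delta fun n => φ i (x n)) : DeltaAlgebra A where
  toMVAlgebra := inferInstance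
  delta := D
  delta_A1 x := hφ _ _ fun i => by
    have := DeltaAlgebra.delta_A1 fun n => φ i (x n)
    simpa only [MVHom.map_cdist, hD, apply_seqCons, MVHom.map_zero] using this
  delta_A2 x := hφ _ _ fun i => by
    have := DeltaAlgebra.delta_A2 fun n => φ i (x n)
    simpa only [hD, apply_seqCons, MVHom.map_zero] using this
  delta_A3 x := hφ _ _ fun i => by rw [hD, DeltaAlgebra.delta_A3]
  delta_A4 x := hφ _ _ fun i => by
    have := DeltaAlgebra.delta_A4 fun n => φ i (x n)
    simpa only [hD, apply_seqCons, MVHom.map_zero] using this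
  delta_A5 x y := by
    rw [← ominus_eq_zero_iff]
    refine hφ _ _ fun i => ?_
    have := DeltaAlgebra.delta_A5 (fun n => φ i (x n)) fun n => φ i (y n)
    rw [← ominus_eq_zero_iff] at this
    simpa only [MVHom.map_ominus, hD, MVHom.map_oplus, MVHom.map_zero] using this
  delta_A6 x y := hφ _ _ fun i => by
    have := DeltaAlgebra.delta_A6 (φ i x) (φ i y)
    simpa only [hD, apply_seqCons, MVHom.map_ominus, MVHom.map_zero] using this

/-- Evaluation at a maximal ideal, as a homomorphism. -/
noncomputable def MaxSpec.hatHom {A : Type u} [MVAlgebra A] (m : MaxSpec A) :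
    MVHom A unitInterval where
  toFun a := hat a m
  map_zero := hat_zero m
  map_neg a := hat_neg a m
  map_oplus a b := hat_oplus a b m

/-- The `δ`-algebra structure transported from `C(Max A)` along a bijective evaluation. -/
@[reducible]
noncomputable def DeltaAlgebra.ofEvalBijective (A : Type u) [MVAlgebra A]
    (h : Function.Bijective (evalHom A)) : DeltaAlgebra A :=
  DeltaAlgebra.ofSeparating MaxSpec.hatHom (fun _ _ hab => h.1 (ContinuousMap.ext hab))
    (fun x => (h.2 ⟨_, unitInterval.continuous_delta fun n => evalHom A (x n)⟩).choose)
    (fun m x => congrArg (fun g => g m)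
      (h.2 ⟨_, unitInterval.continuous_delta fun n => evalHom A (x n)⟩).choose_spec)

/-! ### `δ`-reducts and bijectivity of the evaluation -/

lemma isIso_etaMV_iff (A : MVCat.{u}) :
    IsIso (etaMV A) ↔ Function.Bijective (evalHom A.carrier) := by
  constructor
  · rintro ⟨ψ, h1, h2⟩
    refine Function.bijective_iff_has_inverse.2 ⟨MVHom.toFun ψ, fun a => ?_, fun g => ?_⟩
    · exact congrFun (congrArg MVHom.toFun h1) a
    · exact congrFun (congrArg MVHom.toFun h2) g
  · intro h
    exact ⟨(evalHom A.carrier).inverse h,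
      MVHom.ext (funext (Equiv.ofBijective _ h).symm_apply_apply),
      MVHom.ext (funext (Equiv.ofBijective _ h).apply_symm_apply)⟩

theorem theorem8p1 : (deltaReducts.{u} : ObjectProperty MVCat.{u}) = fixedByEta.{u} := by
  funext A
  refine propext ⟨?_, fun h => ?_⟩
  · rintro ⟨B, rfl⟩
    exact (isIso_etaMV_iff _).2 (DeltaAlgebra.evalHom_bijective (A := B.carrier))
  · exact ⟨@DeltaCat.mk A.carrier (DeltaAlgebra.ofEvalBijective _ ((isIso_etaMV_iff A).1 h)), rfl⟩
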